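/- **Theorem 3.1.** Let $\Gamma$ be a subgroup of finite index in $\Gamma_1=\mathrm{SL}_2(\mathbb Z)$, let $\overline{\Gamma}$ and $\overline{\Gamma}_1$ be the images of $\Gamma$ and $\Gamma_1$ in $\mathrm{PSL}_2(\mathbb Z)$, let $k\ge 2$ be an integer and $w=k-2$. Let $S_k(\Gamma)$ be the space of cusp forms of weight $k$ for $\Gamma$. For $A=\begin{pmatrix}a&b\\c&d\end{pmatrix}\in\Gamma_1$ write $j(A,z)=cz+d$ and $(f|A)(z)=f(Az)\,j(A,z)^{-k}$. Let $V_w$ be the space of complex polynomials of degree at most $w$, with right $\Gamma_1$-action $(P|A)(X)=P(AX)\,j(A,X)^w$, and with the pairing $\langle\sum a_nX^n,\sum b_nX^n\rangle=\sum_{n=0}^w(-1)^{w-n}\binom wn^{-1}a_nb_{w-n}$. Let $V_w^\Gamma$ be the space of maps $P:\Gamma\backslash\Gamma_1\to V_w$ with $P(-A)=(-1)^wP(A)$, on which $\Gamma_1$ acts by $(P|g)(A)=P(Ag^{-1})|g$. For $P,Q\in V_w^\Gamma$ set $$\langle\!\langle P,Q\rangle\!\rangle=\frac1{[\overline\Gamma_1:\overline\Gamma]}\sum_{A\in\overline\Gamma\backslash\overline\Gamma_1}\langle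 P(A),Q(A)\rangle,\qquad \{P,Q\}=\langle\!\langle P|T-P|T^{-1},\,Q\rangle\!\rangle,\qquad T=\begin{pmatrix}1&1\\0&1\end{pmatrix}$$ (each summand is independent of the representative $A$). For $f\in S_k(\Gamma)$ let $\rho_f\in V_w^\Gamma$ be given by $$\rho_f(A)=\int_0^{i\infty}(f|A)(t)\,(t-X)^w\,dt,$$ the integral being taken coefficientwise along the positive imaginary axis, and for $f,g\in S_k(\Gamma)$ let $$(f,g)=\frac1{[\overline\Gamma_1:\overline\Gamma]}\int_{\Gamma\backslash\mathbb H}f(z)\overline{g(z)}\,y^k\,\frac{dx\,dy}{y^2}\qquad(z=x+iy),$$ where the integral is computed on an arbitrary measurable fundamental domain (up to null sets) for the action of $\overline\Gamma$ on $\mathbb H$; such a domain exists. All these integrals converge absolutely. Let $C_k=-(2i)^{k-1}$, and let $\overline P$ be obtained from $P\in V_w^\Gamma$ by conjugating all coefficients. Then for all $f,g\in S_k(\Gamma)$: (a) $6\,C_k\cdot(f,g)=\{\rho_f,\overline{\rho_g}\}$; (b) $\{\rho_f,\rho_g\}=0$. -/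

import Mathlib

open UpperHalfPlane MeasureTheory Polynomial Matrix.SpecialLinearGroup
open scoped MatrixGroups ModularForm ComplexConjugate

noncomputable section

namespace Haberland

/-! ### Polynomials of degree at most `w` -/

/-- The right action `(P|g)(X) = P(gX) j(g,X)^w` of `SL₂(ℤ)` on polynomials of degree at most `w`,
where `gX = (aX+b)/(cX+d)` and `j(g,X) = cX+d`: it sends `∑ pₙ Xⁿ` to
`∑ pₙ (aX+b)ⁿ (cX+d)^(w-n)`. -/
def stroke (w : ℕ) (P : ℂ[X]) (g : SL(2, ℤ)) : ℂ[X] :=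
  ∑ n ∈ Finset.range (w + 1),
    C (P.coeff n) * (C (g 0 0 : ℂ) * X + C (g 0 1 : ℂ)) ^ n *
      (C (g 1 0 : ℂ) * X + C (g 1 1 : ℂ)) ^ (w - n)

/-- The pairing `⟨∑ aₙ Xⁿ, ∑ bₙ Xⁿ⟩ = ∑ (-1)^(w-n) (w choose n)⁻¹ aₙ b_{w-n}` on polynomials
of degree at most `w`. -/
def pairing (w : ℕ) (P Q : ℂ[X]) : ℂ :=
  ∑ n ∈ Finset.range (w + 1),
    (-1) ^ (w - n) * ((w.choose n : ℂ))⁻¹ * P.coeff n * Q.coeff (w - n)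

theorem stroke_mem (w : ℕ) (P : ℂ[X]) (g : SL(2, ℤ)) : stroke w P g ∈ degreeLE ℂ w := by
  refine Submodule.sum_mem _ fun n hn => ?_
  rw [mem_degreeLE, ← natDegree_le_iff_degree_le]
  have hn' : n ≤ w := Nat.lt_succ_iff.mp (Finset.mem_range.mp hn)
  have h1 : ((C (g 0 0 : ℂ) * X + C (g 0 1 : ℂ)) ^ n).natDegree ≤ n := by
    simpa using natDegree_pow_le_of_le n (natDegree_linear_le (a := (g 0 0 : ℂ)) (b := (g 0 1 : ℂ)))
  have h2 : ((C (g 1 0 : ℂ) * X + C (g 1 1 : ℂ)) ^ (w - n)).natDegree ≤ w - n := by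
    simpa using natDegree_pow_le_of_le (w - n)
      (natDegree_linear_le (a := (g 1 0 : ℂ)) (b := (g 1 1 : ℂ)))
  have h3 := natDegree_mul_le_of_le (natDegree_mul_le_of_le
    (natDegree_C (P.coeff n)).le h1) h2
  omega

theorem stroke_smul (w : ℕ) (c : ℂ) (P : ℂ[X]) (g : SL(2, ℤ)) :
    stroke w (c • P) g = c • stroke w P g := by
  simp only [stroke, Finset.smul_sum]
  refine Finset.sum_congr rfl fun n _ => ?_
  rw [coeff_smul, smul_eq_mul, C_mul, smul_eq_C_mul]
  ring

theorem pairing_smul_smul (w : ℕ) (c d : ℂ) (P Q : ℂ[X]) :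
    pairing w (c • P) (d • Q) = c * d * pairing w P Q := by
  simp only [pairing, Finset.mul_sum, coeff_smul, smul_eq_mul]
  exact Finset.sum_congr rfl fun _ _ => by ring

/-! ### The induced module -/

/-- The space `V_w^Γ` of maps `P : Γ\SL₂(ℤ) → V_w` (written as left `Γ`-invariant maps on
`SL₂(ℤ)`), `V_w` being the polynomials of degree at most `w`, with `P(-A) = (-1)^w P(A)`. -/
def inducedModule (Γ : Subgroup SL(2, ℤ)) (w : ℕ) : Submodule ℂ (SL(2, ℤ) → ℂ[X]) where
  carrier := {P | (∀ A, P A ∈ degreeLE ℂ w) ∧ (∀ γ ∈ Γ, ∀ A, P (γ * A) = P A) ∧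
    ∀ A, P (-A) = (-1 : ℂ) ^ w • P A}
  add_mem' hP hQ := ⟨fun A => add_mem (hP.1 A) (hQ.1 A),
    fun γ hγ A => by simp [hP.2.1 γ hγ A, hQ.2.1 γ hγ A],
    fun A => by simp only [Pi.add_apply, hP.2.2 A, hQ.2.2 A, smul_add]⟩
  zero_mem' := ⟨fun _ => zero_mem _, fun _ _ _ => rfl, fun _ => by simp⟩
  smul_mem' c P hP := ⟨fun A => Submodule.smul_mem _ c (hP.1 A),
    fun γ hγ A => by simp [hP.2.1 γ hγ A],
    fun A => by simp only [Pi.smul_apply, hP.2.2 A, smul_comm c]⟩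

variable {Γ : Subgroup SL(2, ℤ)} {w : ℕ}

/-- The action `(P|g)(A) = P(A g⁻¹)|g` of `SL₂(ℤ)` on the induced module. -/
def act (P : inducedModule Γ w) (g : SL(2, ℤ)) : inducedModule Γ w :=
  ⟨fun A => stroke w (P.1 (A * g⁻¹)) g, fun _ => stroke_mem _ _ _,
    fun γ hγ A => by simp only [mul_assoc, P.2.2.1 γ hγ],
    fun A => by simp only [neg_mul, P.2.2.2, stroke_smul]⟩

/-- Complex conjugation of the coefficients. -/
def conjCoeff (P : inducedModule Γ w) : inducedModule Γ w :=
  ⟨fun A => (P.1 A).map (starRingEnd ℂ),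
    fun A => mem_degreeLE.mpr (degree_map_le.trans (mem_degreeLE.mp (P.2.1 A))),
    fun γ hγ A => by simp only [P.2.2.1 γ hγ],
    fun A => by
      simp only [P.2.2.2, Polynomial.map_smul, map_pow, map_neg, map_one]⟩

/-- The subgroup `±Γ` generated by `Γ` and `-1`. Writing `Γ̄` for the image of `Γ` in
`PSL₂(ℤ)`, one has `Γ̄\PSL₂(ℤ) = ±Γ\SL₂(ℤ)` and `[PSL₂(ℤ) : Γ̄] = [SL₂(ℤ) : ±Γ]`. -/
def plusMinus (Γ : Subgroup SL(2, ℤ)) : Subgroup SL(2, ℤ) where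
  carrier := {g | g ∈ Γ ∨ -g ∈ Γ}
  mul_mem' {a b} ha hb := by
    rcases ha with ha | ha <;> rcases hb with hb | hb
    · exact .inl (mul_mem ha hb)
    · exact .inr (by simpa using mul_mem ha hb)
    · exact .inr (by simpa using mul_mem ha hb)
    · exact .inl (by simpa using mul_mem ha hb)
  one_mem' := .inl (one_mem Γ)
  inv_mem' {a} ha := by
    rcases ha with ha | ha
    · exact .inl (inv_mem ha)
    · refine .inr ?_
      have h := inv_mem ha
      rwa [inv_neg] at h

/-- The index `[PSL₂(ℤ) : Γ̄]`, where `Γ̄` is the image of `Γ` in `PSL₂(ℤ)`. -/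
def projIndex (Γ : Subgroup SL(2, ℤ)) : ℕ := (plusMinus Γ).index

/-- The value `⟨P(A), Q(A)⟩` at a coset `A` in `Γ̄\PSL₂(ℤ) = ±Γ\SL₂(ℤ)`; it does not
depend on the representative. -/
def cosetPairing (P Q : inducedModule Γ w)
    (q : Quotient (QuotientGroup.rightRel (plusMinus Γ))) : ℂ :=
  Quotient.lift (fun A : SL(2, ℤ) => pairing w (P.1 A) (Q.1 A)) (by
    intro A B hAB
    have h : B * A⁻¹ ∈ plusMinus Γ := QuotientGroup.rightRel_apply.mp hAB
    have hs : ((-1 : ℂ) ^ w) * (-1) ^ w = 1 := by rw [← mul_pow]; simp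
    rcases h with h | h
    · have hP := P.2.2.1 _ h A
      have hQ := Q.2.2.1 _ h A
      rw [inv_mul_cancel_right] at hP hQ
      simp only [hP, hQ]
    · have hP := P.2.2.1 _ h A
      have hQ := Q.2.2.1 _ h A
      rw [neg_mul, inv_mul_cancel_right, P.2.2.2] at hP
      rw [neg_mul, inv_mul_cancel_right, Q.2.2.2] at hQ
      simp only [← hP, ← hQ, pairing_smul_smul, hs, one_mul]) q

/-- The pairing `⟪P, Q⟫ = [PSL₂(ℤ) : Γ̄]⁻¹ ∑_{A ∈ Γ̄\PSL₂(ℤ)} ⟨P(A), Q(A)⟩`. (For `Γ` of finite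
index, the sum is finite.) -/
def doublePairing (P Q : inducedModule Γ w) : ℂ :=
  (projIndex Γ : ℂ)⁻¹ * ∑ᶠ q, cosetPairing P Q q

/-- The modified pairing `{P, Q} = ⟪P|T - P|T⁻¹, Q⟫`, with `T = (1 1; 0 1)`. -/
def bracket (P Q : inducedModule Γ w) : ℂ :=
  doublePairing (act P ModularGroup.T - act P ModularGroup.T⁻¹) Q

/-! ### Cusp forms, period polynomials and the Petersson product -/

/-- The coefficient of `Xⁿ` in `f|ₖA (t) (t - X)^(k-2) dt` on the path `t = iy`, `dt = i dy`. -/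
def periodIntegrand (k : ℕ) (f : ℍ → ℂ) (A : SL(2, ℤ)) (n : ℕ) (y : ℝ) : ℂ :=
  (f ∣[(k : ℤ)] A) (ofComplex (Complex.I * y)) *
    ((C (Complex.I * y) - X : ℂ[X]) ^ (k - 2)).coeff n * Complex.I

/-- The polynomial `∫_0^{i∞} f|ₖA (t) (t - X)^(k-2) dt`, the integral being taken
coefficientwise along the positive imaginary axis. -/
def periodPolyAt (k : ℕ) (f : ℍ → ℂ) (A : SL(2, ℤ)) : ℂ[X] :=
  ∑ n ∈ Finset.range (k - 2 + 1),
    monomial n (∫ y in Set.Ioi (0 : ℝ), periodIntegrand k f A n y)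

theorem slash_neg_SL (k : ℕ) (f : ℍ → ℂ) (A : SL(2, ℤ)) :
    f ∣[(k : ℤ)] (-A) = (-1 : ℂ) ^ k • (f ∣[(k : ℤ)] A) := by
  ext τ
  rw [Pi.smul_apply, ModularForm.SL_slash_apply, ModularForm.SL_slash_apply, ModularGroup.SL_neg_smul]
  have h : denom ((-A : SL(2, ℤ)) : GL (Fin 2) ℝ) τ = -denom (A : GL (Fin 2) ℝ) τ := by
    simp [denom]; ring
  rw [h, neg_eq_neg_one_mul, mul_zpow, smul_eq_mul]
  simp only [zpow_neg, zpow_natCast, ← inv_pow]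
  norm_num
  ring

/-- The period polynomial `ρ_f ∈ V_w^Γ`, `w = k - 2`, of a cusp form `f` of weight `k ≥ 2`:
`ρ_f(A) = ∫_0^{i∞} f|ₖA (t) (t - X)^w dt`. -/
def periodPoly {k : ℕ} (hk : 2 ≤ k) (f : CuspForm (Γ.map (mapGL ℝ)) (k : ℤ)) :
    inducedModule Γ (k - 2) :=
  ⟨fun A => periodPolyAt k f A,
    fun A => Submodule.sum_mem _ fun n hn => by
      rw [mem_degreeLE]
      refine (degree_monomial_le _ _).trans ?_
      exact_mod_cast Nat.lt_succ_iff.mp (Finset.mem_range.mp hn),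
    fun γ hγ A => by
      have h : (f : ℍ → ℂ) ∣[(k : ℤ)] γ = f :=
        SlashInvariantFormClass.slash_action_eq f _ (Subgroup.mem_map_of_mem _ hγ)
      simp only [periodPolyAt, periodIntegrand, SlashAction.slash_mul, h],
    fun A => by
      have hpow : (-1 : ℂ) ^ k = (-1) ^ (k - 2) := by
        obtain ⟨m, rfl⟩ := Nat.exists_eq_add_of_le hk
        simp [pow_add]
      simp only [periodPolyAt, periodIntegrand, slash_neg_SL, hpow, Finset.smul_sum,
        Pi.smul_apply, smul_eq_mul, mul_assoc, integral_const_mul, smul_monomial]⟩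

/-- The group `Γ̄ = Γ/(Γ ∩ {±1})`, as a group of transformations of the upper half-plane. -/
def projGroup (Γ : Subgroup SL(2, ℤ)) : Subgroup (Equiv.Perm ℍ) :=
  Γ.map (MulAction.toPermHom SL(2, ℤ) ℍ)

/-- The integrand `f(z) conj(g(z)) y^k` of the Petersson product. -/
def peterssonIntegrand (k : ℕ) (f g : ℍ → ℂ) (z : ℍ) : ℂ :=
  f z * conj (g z) * (z.im : ℂ) ^ k

/-- The Petersson product `(f,g) = [PSL₂(ℤ) : Γ̄]⁻¹ ∫_{Γ\ℍ} f(z) conj(g(z)) y^k dx dy / y²`, the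
integral over `Γ\ℍ` being computed on a fundamental domain `D` of `Γ̄`. (Mathlib's `volume` on `ℍ`
is `dx dy / y²`.) -/
def peterssonProduct (Γ : Subgroup SL(2, ℤ)) (D : Set ℍ) (k : ℕ) (f g : ℍ → ℂ) : ℂ :=
  (projIndex Γ : ℂ)⁻¹ * ∫ z in D, peterssonIntegrand k f g z

/-- The constant `C_k = -(2i)^(k-1)`. -/
def haberlandConst (k : ℕ) : ℂ := -(2 * Complex.I) ^ (k - 1)

end Haberland

end

noncomputable section

namespace Haberland

/-! ### Invariance of the pairings -/

/-! Write F_f(z)(A) = (f|A)(z)(z - X)^w (`formValue`) and let E_f(z) be the integral of F_f dt from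
z to i∞ (`eichler`), so that dE_f = -F_f dz. The weight k of f and the weight -w of the kernel (z -
X)^w leave weight 2, so F_f dz is invariant under SL₂(ℤ) acting on the induced module
(`act_formValue`). Hence E_f(Mz)|M - E_f(z) does not depend on z (`act_eichler_sub_eq`). Letting z
tend to i∞ gives 0 for M = T and ρ_f|S = -ρ_f for M = S. At the fixed point z₀ = e^{iπ/3} of U = TS
this says ρ_f = u - u|U with u = E_f(z₀) (`periodPoly_eq`).

Algebra: let s be ρ_g or its conjugate. Since U³ = -1 acts trivially, s|S = -s and s = v - v|U,
invariance of the pairing turns {ρ_f, s} into 3⟪u|T - u, s⟫ (`bracket_eq_of_coboundary`).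

Analysis: let E be E_g or its conjugate, and apply Stokes to the form ⟪F_f, E⟫ dz on the standard
fundamental domain. The vertical sides cancel by T-invariance and the top edge vanishes by
exponential decay, so only the unit arc remains. S reverses the arc and changes the form by -⟪F_f,
s⟫ dz, so twice the arc integral is the integral of ⟪F_f, s⟫ dz along the arc, namely ⟪u|T - u, s⟫
(`two_mul_integral_fdSet`).

If E = E_g, the form is holomorphic and the surface integral is 0, which is (b). If E is the
conjugate of E_g, the surface integrand is a constant times the coset sum of (f|A) conj(g|A) y^w,
because (z - X)^w is a reproducing kernel for the pairing; 2i(2iy)^w supplies C_k, and 3·2 the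
factor 6. Unfolding a fundamental domain of Γ into translates of the standard one
(`setIntegral_peterssonIntegrand`) gives (a). -/

theorem denom_SL (g : SL(2, ℤ)) (z : ℂ) :
    denom (g : GL (Fin 2) ℝ) z = (g 1 0 : ℂ) * z + (g 1 1 : ℂ) := by
  simp [denom]

theorem coe_smul_mul_denom (g : SL(2, ℤ)) (z : ℍ) :
    ((g • z : ℍ) : ℂ) * ((g 1 0 : ℂ) * z + (g 1 1 : ℂ)) = (g 0 0 : ℂ) * z + (g 0 1 : ℂ) := by
  have h := denom_ne_zero (g : GL (Fin 2) ℝ) z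
  rw [denom_SL] at h
  rw [coe_specialLinearGroup_apply]
  simp only [algebraMap_int_eq, eq_intCast, Complex.ofReal_intCast]
  exact div_mul_cancel₀ _ h

theorem det_SL (g : SL(2, ℤ)) : (g 0 0 : ℂ) * g 1 1 - (g 0 1 : ℂ) * g 1 0 = 1 := by
  have h := g.det_coe
  rw [Matrix.det_fin_two] at h
  exact_mod_cast h

theorem natDegree_le_of_mem {w : ℕ} {P : ℂ[X]} (hP : P ∈ degreeLE ℂ w) : P.natDegree ≤ w :=
  natDegree_le_iff_degree_le.mpr (mem_degreeLE.mp hP)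

/-- On the upper half-plane the automorphy factor has no zeros, so the action is an honest
substitution there. Together with `polynomial_ext` this reduces polynomial identities to identities
of Möbius maps. -/
theorem eval_stroke {w : ℕ} {P : ℂ[X]} (hP : P ∈ degreeLE ℂ w) (g : SL(2, ℤ)) (z : ℍ) :
    (stroke w P g).eval (z : ℂ) =
      denom (g : GL (Fin 2) ℝ) z ^ w * P.eval ((g • z : ℍ) : ℂ) := by
  rw [eval_eq_sum_range' (Nat.lt_succ_of_le (natDegree_le_of_mem hP)), Finset.mul_sum, stroke,
    eval_finsetSum]
  refine Finset.sum_congr rfl fun n hn => ?_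
  have hn' : n ≤ w := Nat.lt_succ_iff.mp (Finset.mem_range.mp hn)
  simp only [eval_mul, eval_C, eval_pow, eval_add, eval_X]
  rw [← coe_smul_mul_denom, denom_SL, ← Nat.sub_add_cancel hn', pow_add, mul_pow,
    Nat.add_sub_cancel_right]
  ring

theorem infinite_range_coe : (Set.range ((↑) : ℍ → ℂ)).Infinite := by
  refine Set.infinite_of_injective_forall_mem (f := fun n : ℕ => ((n : ℂ) + Complex.I)) ?_ ?_
  · intro m n h
    simpa using h
  · exact fun n => ⟨⟨(n : ℂ) + Complex.I, by simp⟩, rfl⟩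

theorem polynomial_ext {P Q : ℂ[X]} (h : ∀ z : ℍ, P.eval (z : ℂ) = Q.eval (z : ℂ)) : P = Q :=
  eq_of_infinite_eval_eq P Q (infinite_range_coe.mono (by rintro _ ⟨z, rfl⟩; exact h z))

theorem stroke_add (w : ℕ) (P Q : ℂ[X]) (g : SL(2, ℤ)) :
    stroke w (P + Q) g = stroke w P g + stroke w Q g := by
  simp only [stroke, coeff_add, C_add, add_mul, Finset.sum_add_distrib]

theorem stroke_stroke {w : ℕ} {P : ℂ[X]} (hP : P ∈ degreeLE ℂ w) (g h : SL(2, ℤ)) :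
    stroke w (stroke w P g) h = stroke w P (g * h) := by
  refine polynomial_ext fun z => ?_
  rw [eval_stroke (stroke_mem w P g), eval_stroke hP, eval_stroke hP, mul_smul, ← mul_assoc,
    ← mul_pow]
  congr 2
  have hd := denom_ne_zero (h : GL (Fin 2) ℝ) z
  have h1 := coe_smul_mul_denom h z
  simp only [denom_SL] at hd ⊢
  simp only [Matrix.SpecialLinearGroup.coe_mul, Matrix.mul_apply, Fin.sum_univ_two,
    Int.cast_add, Int.cast_mul]
  linear_combination (g 1 0 : ℂ) * h1

theorem stroke_neg_one {w : ℕ} {P : ℂ[X]} (hP : P ∈ degreeLE ℂ w) :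
    stroke w P (-1) = (-1 : ℂ) ^ w • P := by
  refine polynomial_ext fun z => ?_
  rw [eval_stroke hP, ModularGroup.SL_neg_smul, one_smul, denom_SL]
  simp

theorem coeff_C_sub_X_pow (w n : ℕ) (t : ℂ) :
    ((C t - X : ℂ[X]) ^ w).coeff n = (-1) ^ n * t ^ (w - n) * (w.choose n : ℂ) := by
  have h : (C t - X : ℂ[X]) = C (-1) * (X + C (-t)) := by simp; ring
  rw [h, mul_pow, ← C_pow, coeff_C_mul, coeff_X_add_C_pow]
  rcases le_or_gt n w with hn | hn
  · obtain ⟨m, rfl⟩ := Nat.exists_eq_add_of_le hn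
    rw [Nat.add_sub_cancel_left, neg_pow t, pow_add]
    have : ((-1 : ℂ) ^ m) * (-1) ^ m = 1 := by rw [← mul_pow]; simp
    linear_combination (-1) ^ n * t ^ m * ((n + m).choose n : ℂ) * this
  · simp [Nat.choose_eq_zero_of_lt hn]

theorem C_sub_X_pow_mem (w : ℕ) (t : ℂ) : (C t - X : ℂ[X]) ^ w ∈ degreeLE ℂ w := by
  rw [mem_degreeLE, ← natDegree_le_iff_degree_le]
  have h : (C t - X : ℂ[X]).natDegree ≤ 1 := by
    rw [natDegree_sub]
    exact (natDegree_X_sub_C t).le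
  simpa using natDegree_pow_le_of_le w h

/-- The binomial coefficients of the power cancel the inverse weights of the pairing: (t - X)^w is
its reproducing kernel. -/
theorem pairing_C_sub_X_pow_right {w : ℕ} {P : ℂ[X]} (hP : P ∈ degreeLE ℂ w) (t : ℂ) :
    pairing w P ((C t - X) ^ w) = P.eval t := by
  rw [eval_eq_sum_range' (Nat.lt_succ_of_le (natDegree_le_of_mem hP)), pairing]
  refine Finset.sum_congr rfl fun n hn => ?_
  have hn' : n ≤ w := Nat.lt_succ_iff.mp (Finset.mem_range.mp hn)
  have h0 : (w.choose n : ℂ) ≠ 0 := by exact_mod_cast (Nat.choose_pos hn').ne'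
  have : ((-1 : ℂ) ^ (w - n)) * (-1) ^ (w - n) = 1 := by rw [← mul_pow]; simp
  rw [coeff_C_sub_X_pow, Nat.sub_sub_self hn', Nat.choose_symm hn']
  field_simp
  linear_combination P.coeff n * t ^ n * this

theorem pairing_C_sub_X_pow_left {w : ℕ} {P : ℂ[X]} (hP : P ∈ degreeLE ℂ w) (t : ℂ) :
    pairing w ((C t - X) ^ w) P = (-1) ^ w * P.eval t := by
  rw [eval_eq_sum_range' (Nat.lt_succ_of_le (natDegree_le_of_mem hP)), pairing,
    ← Finset.sum_range_reflect, Finset.mul_sum]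
  refine Finset.sum_congr rfl fun n hn => ?_
  have hn' : n ≤ w := Nat.lt_succ_iff.mp (Finset.mem_range.mp hn)
  have h0 : (w.choose n : ℂ) ≠ 0 := by exact_mod_cast (Nat.choose_pos hn').ne'
  rw [show w + 1 - 1 - n = w - n by omega, coeff_C_sub_X_pow, Nat.sub_sub_self hn',
    Nat.choose_symm hn']
  field_simp
  rw [mul_assoc, mul_comm _ (P.coeff n), ← pow_add, Nat.add_sub_cancel' hn', mul_comm]

/-- The pairing as a bilinear form. -/
def pairingForm (w : ℕ) : ℂ[X] →ₗ[ℂ] ℂ[X] →ₗ[ℂ] ℂ :=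
  LinearMap.mk₂ ℂ (pairing w)
    (fun P P' Q => by
      simp only [pairing, coeff_add, ← Finset.sum_add_distrib]
      exact Finset.sum_congr rfl fun _ _ => by ring)
    (fun c P Q => by simpa using pairing_smul_smul w c 1 P Q)
    (fun P Q Q' => by
      simp only [pairing, coeff_add, ← Finset.sum_add_distrib]
      exact Finset.sum_congr rfl fun _ _ => by ring)
    (fun c P Q => by simpa using pairing_smul_smul w 1 c P Q)

theorem pairingForm_apply (w : ℕ) (P Q : ℂ[X]) : pairingForm w P Q = pairing w P Q := rfl

/-- The stroke operator as a linear map. -/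
def strokeHom (w : ℕ) (g : SL(2, ℤ)) : ℂ[X] →ₗ[ℂ] ℂ[X] where
  toFun P := stroke w P g
  map_add' P Q := stroke_add w P Q g
  map_smul' c P := stroke_smul w c P g

theorem strokeHom_apply (w : ℕ) (g : SL(2, ℤ)) (P : ℂ[X]) : strokeHom w g P = stroke w P g := rfl

theorem map_eq_sum_coeff {w : ℕ} {P : ℂ[X]} (hP : P ∈ degreeLE ℂ w) (L : ℂ[X] →ₗ[ℂ] ℂ) :
    L P = ∑ n ∈ Finset.range (w + 1), P.coeff n * L (X ^ n) := by
  conv_lhs => rw [as_sum_range' P (w + 1) (Nat.lt_succ_of_le (natDegree_le_of_mem hP))]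
  rw [map_sum]
  refine Finset.sum_congr rfl fun n _ => ?_
  rw [← C_mul_X_pow_eq_monomial, ← smul_eq_C_mul, map_smul, smul_eq_mul]

/-- The powers `(t - X)^w`, `t` in the upper half-plane, separate linear functionals on the
polynomials of degree at most `w`. -/
theorem linearMap_eq_zero_of_powers {w : ℕ} (L : ℂ[X] →ₗ[ℂ] ℂ)
    (hL : ∀ z : ℍ, L ((C (z : ℂ) - X) ^ w) = 0) {Q : ℂ[X]} (hQ : Q ∈ degreeLE ℂ w) : L Q = 0 := by
  -- `R` is L((t - X)^w) regarded as a polynomial in t. It vanishes on the upper half-plane, and its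
  -- coefficients are nonzero multiples of the values L(Xⁿ).
  set R : ℂ[X] := ∑ n ∈ Finset.range (w + 1),
    monomial (w - n) ((-1) ^ n * (w.choose n : ℂ) * L (X ^ n)) with hR
  have hR0 : R = 0 := by
    refine polynomial_ext fun z => ?_
    have := map_eq_sum_coeff (C_sub_X_pow_mem w (z : ℂ)) L
    rw [hL] at this
    rw [eval_zero, this, hR, eval_finsetSum]
    refine Finset.sum_congr rfl fun n _ => ?_
    rw [eval_monomial, coeff_C_sub_X_pow]
    ring
  rw [map_eq_sum_coeff hQ]
  refine Finset.sum_eq_zero fun n hn => ?_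
  have hn' : n ≤ w := Nat.lt_succ_iff.mp (Finset.mem_range.mp hn)
  have h1 : R.coeff (w - n) = (-1) ^ n * (w.choose n : ℂ) * L (X ^ n) := by
    rw [hR, finsetSum_coeff, Finset.sum_eq_single_of_mem n hn]
    · simp
    · intro m hm hmn
      have hm' : m ≤ w := Nat.lt_succ_iff.mp (Finset.mem_range.mp hm)
      rw [coeff_monomial, if_neg (by omega)]
  have h0 : (w.choose n : ℂ) ≠ 0 := by exact_mod_cast (Nat.choose_pos hn').ne'
  rw [hR0, coeff_zero] at h1
  have : L (X ^ n) = 0 := by simpa [h0] using h1.symm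
  rw [this, mul_zero]

/-- This is the w-th power of (gz - gt) j(g,z) j(g,t) = z - t, which holds because det g = 1. -/
theorem stroke_C_sub_X_pow (w : ℕ) (g : SL(2, ℤ)) (z : ℍ) :
    denom (g : GL (Fin 2) ℝ) z ^ w • stroke w ((C ((g • z : ℍ) : ℂ) - X) ^ w) g =
      (C (z : ℂ) - X) ^ w := by
  refine polynomial_ext fun t => ?_
  rw [eval_smul, eval_stroke (C_sub_X_pow_mem w _), smul_eq_mul]
  simp only [eval_pow, eval_sub, eval_C, eval_X, ← mul_pow]
  congr 1
  have h1 := coe_smul_mul_denom g z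
  have h2 := coe_smul_mul_denom g t
  have h3 := det_SL g
  simp only [denom_SL]
  linear_combination ((g 1 0 : ℂ) * t + g 1 1) * h1 - ((g 1 0 : ℂ) * z + g 1 1) * h2 + (z - t) * h3

/-- It suffices to test Q on the kernels (z - X)^w; there both sides are evaluations of P, once z is
written as a translate under g. -/
theorem pairing_stroke {w : ℕ} {P Q : ℂ[X]} (hP : P ∈ degreeLE ℂ w) (hQ : Q ∈ degreeLE ℂ w)
    (g : SL(2, ℤ)) : pairing w (stroke w P g) (stroke w Q g) = pairing w P Q := by
  have := linearMap_eq_zero_of_powers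
    ((pairingForm w (stroke w P g)).comp (strokeHom w g) - pairingForm w P) (fun z => ?_) hQ
  · simpa [sub_eq_zero, pairingForm_apply, strokeHom_apply] using this
  obtain ⟨z, rfl⟩ : ∃ z' : ℍ, g • z' = z := ⟨g⁻¹ • z, smul_inv_smul g z⟩
  have hd : denom (g : GL (Fin 2) ℝ) z ^ w ≠ 0 := pow_ne_zero _ (denom_ne_zero _ z)
  rw [LinearMap.sub_apply, LinearMap.comp_apply, strokeHom_apply, pairingForm_apply,
    pairingForm_apply, pairing_C_sub_X_pow_right hP, sub_eq_zero]
  apply mul_left_cancel₀ hd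
  rw [← eval_stroke hP, ← pairing_C_sub_X_pow_right (stroke_mem w P g), ← stroke_C_sub_X_pow w g z]
  simpa using (pairing_smul_smul w 1 (denom (g : GL (Fin 2) ℝ) z ^ w) (stroke w P g)
    (stroke w ((C ((g • z : ℍ) : ℂ) - X) ^ w) g)).symm

/-! ### The double pairing -/

section

variable {Γ : Subgroup SL(2, ℤ)} {w : ℕ}

theorem act_add (P Q : inducedModule Γ w) (g : SL(2, ℤ)) : act (P + Q) g = act P g + act Q g :=
  Subtype.ext (funext fun _ => stroke_add _ _ _ _)

theorem act_smul (c : ℂ) (P : inducedModule Γ w) (g : SL(2, ℤ)) : act (c • P) g = c • act P g :=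
  Subtype.ext (funext fun _ => stroke_smul _ _ _ _)

/-- The action of an element of `SL₂(ℤ)` on the induced module as a linear map. -/
def actHom (g : SL(2, ℤ)) : inducedModule Γ w →ₗ[ℂ] inducedModule Γ w where
  toFun P := act P g
  map_add' P Q := act_add P Q g
  map_smul' c P := act_smul c P g

theorem act_sub (P Q : inducedModule Γ w) (g : SL(2, ℤ)) : act (P - Q) g = act P g - act Q g :=
  map_sub (actHom g) P Q

theorem act_neg (P : inducedModule Γ w) (g : SL(2, ℤ)) : act (-P) g = -act P g :=
  map_neg (actHom g) P

theorem act_act (P : inducedModule Γ w) (g h : SL(2, ℤ)) : act (act P g) h = act P (g * h) := by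
  refine Subtype.ext (funext fun A => ?_)
  change stroke w (stroke w (P.1 (A * h⁻¹ * g⁻¹)) g) h = stroke w (P.1 (A * (g * h)⁻¹)) (g * h)
  rw [stroke_stroke (P.2.1 _), mul_inv_rev, mul_assoc]

/-- The sign (-1)^w from the parity condition cancels the one from the action on polynomials, so the
action factors through PSL₂(ℤ). -/
theorem act_neg_one (P : inducedModule Γ w) : act P (-1) = P := by
  refine Subtype.ext (funext fun A => ?_)
  change stroke w (P.1 (A * (-1)⁻¹)) (-1) = P.1 A
  have hs : ((-1 : ℂ) ^ w) * (-1) ^ w = 1 := by rw [← mul_pow]; simp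
  rw [stroke_neg_one (P.2.1 _), inv_neg, inv_one, mul_neg, mul_one, P.2.2.2, smul_smul, hs,
    one_smul]

theorem act_one (P : inducedModule Γ w) : act P 1 = P := by
  have := act_act P (-1) (-1)
  rwa [act_neg_one, act_neg_one, neg_mul_neg, one_mul, eq_comm] at this

theorem conjCoeff_sub (P Q : inducedModule Γ w) :
    conjCoeff (P - Q) = conjCoeff P - conjCoeff Q :=
  Subtype.ext (funext fun _ => Polynomial.map_sub _)

theorem conjCoeff_act (P : inducedModule Γ w) (g : SL(2, ℤ)) :
    conjCoeff (act P g) = act (conjCoeff P) g := by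
  refine Subtype.ext (funext fun A => ?_)
  change (stroke w (P.1 (A * g⁻¹)) g).map _ = stroke w ((P.1 (A * g⁻¹)).map _) g
  simp [stroke, Polynomial.map_sum]

/-! ### Coset sums for a subgroup of finite index -/

instance [Γ.FiniteIndex] : (plusMinus Γ).FiniteIndex :=
  Subgroup.finiteIndex_of_le (H := Γ) fun _ h => Or.inl h

instance [Γ.FiniteIndex] : Finite (Quotient (QuotientGroup.rightRel (plusMinus Γ))) :=
  Finite.of_equiv _ (QuotientGroup.quotientRightRelEquivQuotientLeftRel (plusMinus Γ)).symm

instance [Γ.FiniteIndex] : Fintype (Quotient (QuotientGroup.rightRel (plusMinus Γ))) :=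
  Fintype.ofFinite _

theorem cosetPairing_eq_out (P Q : inducedModule Γ w)
    (q : Quotient (QuotientGroup.rightRel (plusMinus Γ))) :
    cosetPairing P Q q = pairing w (P.1 q.out) (Q.1 q.out) := by
  conv_lhs => rw [← q.out_eq]
  rfl

theorem doublePairing_eq_sum [Γ.FiniteIndex] (P Q : inducedModule Γ w) :
    doublePairing P Q = (projIndex Γ : ℂ)⁻¹ *
      ∑ q : Quotient (QuotientGroup.rightRel (plusMinus Γ)),
        pairing w (P.1 q.out) (Q.1 q.out) := by
  rw [doublePairing, finsum_eq_sum_of_fintype]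
  simp only [cosetPairing_eq_out]

/-- The double pairing as a bilinear form. -/
def doublePairingForm (Γ : Subgroup SL(2, ℤ)) [Γ.FiniteIndex] (w : ℕ) :
    inducedModule Γ w →ₗ[ℂ] inducedModule Γ w →ₗ[ℂ] ℂ :=
  LinearMap.mk₂ ℂ doublePairing
    (fun P P' Q => by
      simp only [doublePairing_eq_sum, ← mul_add, ← Finset.sum_add_distrib, ← pairingForm_apply]
      simp)
    (fun c P Q => by
      simp only [doublePairing_eq_sum, ← pairingForm_apply]
      simp [← Finset.mul_sum, mul_left_comm])
    (fun P P' Q => by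
      simp only [doublePairing_eq_sum, ← mul_add, ← Finset.sum_add_distrib, ← pairingForm_apply]
      simp)
    (fun c P Q => by
      simp only [doublePairing_eq_sum, ← pairingForm_apply]
      simp [← Finset.mul_sum, mul_left_comm])

theorem doublePairingForm_apply [Γ.FiniteIndex] (P Q : inducedModule Γ w) :
    doublePairingForm Γ w P Q = doublePairing P Q := rfl

/-- Right multiplication on the right cosets of a subgroup. -/
def cosetMulRight {G : Type*} [Group G] (H : Subgroup G) (g : G) :
    Quotient (QuotientGroup.rightRel H) ≃ Quotient (QuotientGroup.rightRel H) :=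
  Quotient.congr (Equiv.mulRight g) fun a b => by
    simp only [QuotientGroup.rightRel_apply, Equiv.coe_mulRight, mul_inv_rev,
      mul_assoc, mul_inv_cancel_left]

/-- Right translation by g⁻¹ permutes the cosets, and the pairing on polynomials is invariant. -/
theorem doublePairing_act (P Q : inducedModule Γ w) (g : SL(2, ℤ)) :
    doublePairing (act P g) (act Q g) = doublePairing P Q := by
  rw [doublePairing, doublePairing,
    ← finsum_comp_equiv (cosetMulRight (plusMinus Γ) g⁻¹) (f := cosetPairing P Q)]
  congr 1
  refine finsum_congr fun q => ?_
  induction q using Quotient.inductionOn with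
  | h A => exact pairing_stroke (P.2.1 _) (Q.2.1 _) g

open ModularGroup in
/-- The algebraic part of Haberland's formula. -/
theorem bracket_eq_of_coboundary [Γ.FiniteIndex] {r s u v : inducedModule Γ w}
    (hr : r = u - act u (T * S)) (hs : s = v - act v (T * S))
    (hrS : act r S = -r) (hsS : act s S = -s) :
    bracket r s = 3 * doublePairing (act u T - u) s := by
  set B := doublePairingForm Γ w with hB
  set U : SL(2, ℤ) := T * S with hU
  have hSinv : S⁻¹ = -S := by decide
  have hU3 : U * U * U = -1 := by decide
  have hT : T = U * S⁻¹ := by rw [hU, mul_inv_cancel_right]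
  have hT' : T⁻¹ = S * U⁻¹ := by rw [hU, mul_inv_rev, mul_inv_cancel_left]
  have hUinv : U⁻¹ = -1 * (U * U) := by
    rw [inv_eq_iff_mul_eq_one, neg_one_mul, mul_neg, ← mul_assoc, hU3, neg_neg]
  have hsS' : act s S⁻¹ = -s := by
    rw [hSinv, ← neg_one_mul, ← act_act, act_neg_one, hsS]
  have hinv : ∀ (P Q : inducedModule Γ w) (g : SL(2, ℤ)), B (act P g) (act Q g) = B P Q :=
    fun P Q g => doublePairing_act P Q g
  -- Since s|S⁻¹ = -s, a factor S⁻¹ on the left argument can be traded for a sign; this replaces T =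
  -- US⁻¹ by U.
  have key : ∀ P : inducedModule Γ w, B (act P S⁻¹) s = -B P s := by
    intro P
    have := hinv P s S⁻¹
    rw [hsS', map_neg] at this
    linear_combination -this
  have huT : B (act u T) s = -B (act u U) s := by rw [hT, ← act_act, key]
  have hrT : B (act r T) s = -B (act r U) s := by rw [hT, ← act_act, key]
  have hrT' : B (act r T⁻¹) s = -B (act r U⁻¹) s := by
    rw [hT', ← act_act, hrS, act_neg, map_neg, LinearMap.neg_apply]
  have hrU : act r U = act u U - act u (U * U) := by rw [hr, act_sub, act_act]
  have hrU' : act r U⁻¹ = act u (U * U) - u := by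
    rw [hr, act_sub, act_act, mul_inv_cancel, act_one, hUinv, ← act_act, act_neg_one]
  -- The sum of the U-translates of u is U-invariant, hence orthogonal to the coboundary s = v -
  -- v|U.
  have hsum : B (act u (U * U)) s + B (act u U) s + B u s = 0 := by
    have h3 : act (act u (U * U)) U = u := by rw [act_act, hU3, act_neg_one]
    have e0 := hinv (act u (U * U)) v U
    have e1 := hinv u v U
    have e2 := hinv (act u U) v U
    rw [h3] at e0
    rw [act_act] at e2
    rw [hs, map_sub, map_sub, map_sub]
    linear_combination -e0 - e1 - e2
  rw [bracket, ← doublePairingForm_apply, ← doublePairingForm_apply, ← hB, map_sub, map_sub,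
    LinearMap.sub_apply, LinearMap.sub_apply, hrT, hrT', huT, hrU, hrU', map_sub, map_sub,
    LinearMap.sub_apply, LinearMap.sub_apply]
  linear_combination 2 * hsum

end

/-! ### Functions with exponential decay in vertical strips -/

/-- Exponential decay at `i∞`, uniformly on every vertical strip, of a function on the upper
half-plane. -/
def StripDecay (ψ : ℂ → ℂ) : Prop :=
  ∀ δ > 0, ∀ B : ℝ, ∃ C ≥ 0, ∃ c > 0, ∀ z : ℂ, δ ≤ z.im → |z.re| ≤ B →
    ‖ψ z‖ ≤ C * Real.exp (-c * z.im)

theorem StripDecay.mono {ψ χ : ℂ → ℂ} (hψ : StripDecay ψ) (K : ℝ)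
    (h : ∀ z : ℂ, 0 < z.im → ‖χ z‖ ≤ K * ‖ψ z‖) : StripDecay χ := by
  intro δ hδ B
  obtain ⟨C, hC, c, hc, hb⟩ := hψ δ hδ B
  refine ⟨|K| * C, by positivity, c, hc, fun z hz hzB => ?_⟩
  calc ‖χ z‖ ≤ K * ‖ψ z‖ := h z (hδ.trans_le hz)
    _ ≤ |K| * (C * Real.exp (-c * z.im)) :=
      mul_le_mul (le_abs_self K) (hb z hz hzB) (norm_nonneg _) (abs_nonneg K)
    _ = _ := by ring

theorem StripDecay.zero : StripDecay (fun _ => 0) :=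
  fun _ _ _ => ⟨0, le_rfl, 1, one_pos, fun _ _ _ => by simp⟩

theorem StripDecay.add {ψ χ : ℂ → ℂ} (hψ : StripDecay ψ) (hχ : StripDecay χ) :
    StripDecay (fun z => ψ z + χ z) := by
  intro δ hδ B
  obtain ⟨C, hC, c, hc, hb⟩ := hψ δ hδ B
  obtain ⟨C', hC', c', hc', hb'⟩ := hχ δ hδ B
  refine ⟨C + C', by positivity, min c c', lt_min hc hc', fun z hz hzB => ?_⟩
  have hz0 : 0 ≤ z.im := (hδ.trans_le hz).le
  calc ‖ψ z + χ z‖ ≤ C * Real.exp (-c * z.im) + C' * Real.exp (-c' * z.im) :=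
        (norm_add_le _ _).trans (add_le_add (hb z hz hzB) (hb' z hz hzB))
    _ ≤ C * Real.exp (-min c c' * z.im) + C' * Real.exp (-min c c' * z.im) := by
        gcongr
        · exact min_le_left _ _
        · exact min_le_right _ _
    _ = _ := by ring

theorem StripDecay.sum {ι : Type*} (s : Finset ι) {ψ : ι → ℂ → ℂ}
    (h : ∀ i ∈ s, StripDecay (ψ i)) : StripDecay (fun z => ∑ i ∈ s, ψ i z) := by
  classical
  induction s using Finset.induction_on with
  | empty => simpa using StripDecay.zero
  | insert i s hi ih =>
    simp only [Finset.sum_insert hi]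
    exact (h i (Finset.mem_insert_self i s)).add
      (ih fun j hj => h j (Finset.mem_insert_of_mem hj))

theorem StripDecay.const_mul {ψ : ℂ → ℂ} (hψ : StripDecay ψ) (a : ℂ) :
    StripDecay (fun z => a * ψ z) :=
  hψ.mono ‖a‖ fun z _ => (norm_mul a (ψ z)).le

theorem StripDecay.conj {ψ : ℂ → ℂ} (hψ : StripDecay ψ) : StripDecay (fun z => conj (ψ z)) :=
  hψ.mono 1 fun z _ => by simp

theorem StripDecay.mul {ψ χ : ℂ → ℂ} (hψ : StripDecay ψ) (hχ : StripDecay χ) :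
    StripDecay (fun z => ψ z * χ z) := by
  intro δ hδ B
  obtain ⟨C, hC, c, hc, hb⟩ := hψ δ hδ B
  obtain ⟨C', hC', c', hc', hb'⟩ := hχ δ hδ B
  refine ⟨C * C', by positivity, c + c', by positivity, fun z hz hzB => ?_⟩
  rw [norm_mul]
  calc ‖ψ z‖ * ‖χ z‖ ≤ (C * Real.exp (-c * z.im)) * (C' * Real.exp (-c' * z.im)) := by
        gcongr
        · exact hb z hz hzB
        · exact hb' z hz hzB
    _ = C * C' * (Real.exp (-c * z.im) * Real.exp (-c' * z.im)) := by ring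
    _ = _ := by rw [← Real.exp_add]; ring_nf

/-- In the strip above height δ, |z| is at most a constant times y, and y ≤ (2/c) exp(cy/2); the
factor z thus costs half of the rate c. -/
theorem StripDecay.coord_mul {ψ : ℂ → ℂ} (hψ : StripDecay ψ) : StripDecay (fun z => z * ψ z) := by
  intro δ hδ B
  obtain ⟨C, hC, c, hc, hb⟩ := hψ δ hδ B
  refine ⟨(|B| / δ + 1) * (2 / c) * C, by positivity, c / 2, by positivity, fun z hz hzB => ?_⟩
  have hz0 : 0 < z.im := hδ.trans_le hz
  have h1 : ‖z‖ ≤ (|B| / δ + 1) * z.im := by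
    have h2 : |B| ≤ |B| / δ * z.im := by
      rw [div_mul_eq_mul_div, le_div_iff₀ hδ]
      gcongr
    have h3 := Complex.norm_le_abs_re_add_abs_im z
    rw [abs_of_pos hz0] at h3
    linarith [hzB.trans (le_abs_self B)]
  have h4 : z.im ≤ 2 / c * Real.exp (c / 2 * z.im) := by
    have := Real.add_one_le_exp (c / 2 * z.im)
    calc z.im = 2 / c * (c / 2 * z.im) := by field_simp
      _ ≤ _ := by gcongr; linarith
  rw [norm_mul]
  calc ‖z‖ * ‖ψ z‖
      ≤ ((|B| / δ + 1) * (2 / c * Real.exp (c / 2 * z.im))) * (C * Real.exp (-c * z.im)) := by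
        gcongr
        · exact h1.trans (by gcongr)
        · exact hb z hz hzB
    _ = (|B| / δ + 1) * (2 / c) * C * (Real.exp (c / 2 * z.im) * Real.exp (-c * z.im)) := by ring
    _ = _ := by rw [← Real.exp_add]; ring_nf

theorem StripDecay.pow_mul {ψ : ℂ → ℂ} (hψ : StripDecay ψ) (n : ℕ) :
    StripDecay (fun z => z ^ n * ψ z) := by
  induction n with
  | zero => simpa using hψ
  | succ n ih => simpa only [pow_succ', mul_assoc] using ih.coord_mul

/-! ### Primitives defined by vertical integrals -/

/-- The integral of `ψ(t) dt` along the vertical half-line from `z` to `i∞`. -/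
def vertInt (ψ : ℂ → ℂ) (z : ℂ) : ℂ := ∫ s in Set.Ioi (0 : ℝ), ψ (z + s * Complex.I) * Complex.I

theorem continuousOn_vertical {ψ : ℂ → ℂ} (hd : DifferentiableOn ℂ ψ {z | 0 < z.im})
    {z : ℂ} (hz : 0 < z.im) :
    ContinuousOn (fun s : ℝ => ψ (z + s * Complex.I) * Complex.I) (Set.Ici 0) := by
  refine ContinuousOn.mul (hd.continuousOn.comp (by fun_prop) fun s hs => ?_) continuousOn_const
  have : (0 : ℝ) ≤ s := hs
  simp
  linarith

theorem aestronglyMeasurable_vertical {ψ : ℂ → ℂ} (hd : DifferentiableOn ℂ ψ {z | 0 < z.im})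
    {z : ℂ} (hz : 0 < z.im) :
    AEStronglyMeasurable (fun s : ℝ => ψ (z + s * Complex.I) * Complex.I)
      (volume.restrict (Set.Ioi 0)) :=
  ((continuousOn_vertical hd hz).mono Set.Ioi_subset_Ici_self).aestronglyMeasurable
    measurableSet_Ioi

theorem integrableOn_vertical {ψ : ℂ → ℂ} (hd : DifferentiableOn ℂ ψ {z | 0 < z.im})
    (hs : StripDecay ψ) {z : ℂ} (hz : 0 < z.im) :
    IntegrableOn (fun s : ℝ => ψ (z + s * Complex.I) * Complex.I) (Set.Ioi 0) := by
  obtain ⟨C, hC, c, hc, hb⟩ := hs z.im hz |z.re|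
  refine Integrable.mono' (((exp_neg_integrableOn_Ioi 0 hc).const_mul C))
    (aestronglyMeasurable_vertical hd hz) ?_
  filter_upwards [ae_restrict_mem measurableSet_Ioi] with s hs0
  have hs0 : (0 : ℝ) < s := hs0
  have := hb (z + s * Complex.I) (by simp [hs0.le]) (by simp)
  simp only [norm_mul, Complex.norm_I, mul_one]
  refine this.trans (mul_le_mul_of_nonneg_left (Real.exp_le_exp.mpr ?_) hC)
  simp
  nlinarith

/-- The vertical half-line stays in the strip, so integrating the bound keeps the rate c. -/
theorem stripDecay_vertInt {ψ : ℂ → ℂ} (hs : StripDecay ψ) : StripDecay (vertInt ψ) := by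
  intro δ hδ B
  obtain ⟨C, hC, c, hc, hb⟩ := hs δ hδ B
  refine ⟨C * ∫ s in Set.Ioi (0 : ℝ), Real.exp (-c * s), ?_, c, hc, fun z hz hzB => ?_⟩
  · exact mul_nonneg hC (integral_nonneg fun _ => (Real.exp_pos _).le)
  · calc ‖vertInt ψ z‖
        ≤ ∫ s in Set.Ioi (0 : ℝ), C * Real.exp (-c * z.im) * Real.exp (-c * s) := by
          refine norm_integral_le_of_norm_le ((exp_neg_integrableOn_Ioi 0 hc).const_mul _) ?_
          filter_upwards [ae_restrict_mem measurableSet_Ioi] with s hs0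
          have hs0 : (0 : ℝ) < s := hs0
          have := hb (z + s * Complex.I) (by simp; linarith) (by simpa using hzB)
          simp only [norm_mul, Complex.norm_I, mul_one]
          refine this.trans (le_of_eq ?_)
          rw [mul_assoc, ← Real.exp_add]
          simp [mul_add]
      _ = _ := by rw [integral_const_mul]; ring

/-- Differentiating under the integral sign produces ψ'(z + si)i, the s-derivative of ψ(z + si),
whose integral is -ψ(z) since ψ vanishes at i∞. Cauchy's estimate for ψ' on circles of radius `r`
provides the dominating function. -/
theorem hasDerivAt_vertInt {ψ : ℂ → ℂ} (hd : DifferentiableOn ℂ ψ {z | 0 < z.im})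
    (hs : StripDecay ψ) {z : ℂ} (hz : 0 < z.im) : HasDerivAt (vertInt ψ) (-ψ z) z := by
  have hopen : IsOpen {z : ℂ | 0 < z.im} := isOpen_lt continuous_const Complex.continuous_im
  -- A quarter of the height leaves room: parameters move within `r` of z and Cauchy circles add
  -- another `r`, so everything stays above height 2r.
  set r := z.im / 4 with hr
  have hr0 : 0 < r := by positivity
  have him : ∀ x ∈ Metric.ball z (2 * r), 2 * r < x.im ∧ |x.re| ≤ |z.re| + 2 * r := by
    intro x hx
    rw [Metric.mem_ball, dist_eq_norm] at hx
    have h1 := (Complex.abs_im_le_norm (x - z)).trans_lt hx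
    have h2 := (Complex.abs_re_le_norm (x - z)).trans_lt hx
    rw [Complex.sub_im, abs_lt] at h1
    rw [Complex.sub_re] at h2
    refine ⟨by linarith, ?_⟩
    have h3 := abs_add_le (x.re - z.re) z.re
    rw [sub_add_cancel] at h3
    linarith
  obtain ⟨C, hC, c, hc, hb⟩ := hs (2 * r) (by positivity) (|z.re| + 2 * r)
  have hderiv : ∀ x : ℂ, 0 < x.im → ∀ s : ℝ, 0 < s →
      HasDerivAt ψ (deriv ψ (x + s * Complex.I)) (x + s * Complex.I) := fun x hx s hs0 =>
    (hd.differentiableAt (hopen.mem_nhds (by simp; linarith))).hasDerivAt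
  have key := hasDerivAt_integral_of_dominated_loc_of_deriv_le (μ := volume.restrict (Set.Ioi 0))
    (F := fun x (s : ℝ) => ψ (x + s * Complex.I) * Complex.I)
    (F' := fun x (s : ℝ) => deriv ψ (x + s * Complex.I) * Complex.I)
    (bound := fun s => C / r * Real.exp (-c * s))
    (Metric.ball_mem_nhds z hr0) ?_ (integrableOn_vertical hd hs hz) ?_ ?_ ?_ ?_
  · have hlim : Filter.Tendsto (fun s : ℝ => ψ (z + s * Complex.I)) Filter.atTop (nhds 0) := by
      refine squeeze_zero_norm' (a := fun s : ℝ => C * Real.exp (-c * s)) ?_ ?_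
      · filter_upwards [Filter.eventually_ge_atTop 0] with s hs0
        have := hb (z + s * Complex.I) (by simp; linarith) (by simp; positivity)
        refine this.trans (mul_le_mul_of_nonneg_left (Real.exp_le_exp.mpr ?_) hC)
        simp
        nlinarith
      · have : Filter.Tendsto (fun s : ℝ => -c * s) Filter.atTop Filter.atBot :=
          Filter.tendsto_id.const_mul_atTop_of_neg (by linarith)
        simpa using (Real.tendsto_exp_atBot.comp this).const_mul C
    have hint := integral_Ioi_of_hasDerivAt_of_tendsto (a := 0)
      (f := fun s : ℝ => ψ (z + s * Complex.I)) (m := 0)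
      (f' := fun s : ℝ => deriv ψ (z + s * Complex.I) * Complex.I) ?_ ?_ key.1 hlim
    · have h2 := key.2
      rw [hint] at h2
      simp only [Complex.ofReal_zero, zero_mul, add_zero, zero_sub] at h2
      exact h2
    · have := (continuousOn_vertical hd hz).mul (continuousOn_const (c := -Complex.I))
      refine ContinuousWithinAt.congr (this 0 Set.self_mem_Ici) ?_ ?_ <;> simp [mul_assoc]
    · intro s hs0
      have h1 := hderiv z hz s hs0
      have h2 : HasDerivAt (fun s : ℝ => z + s * Complex.I) Complex.I s := by
        simpa using ((Complex.ofRealCLM.hasDerivAt (x := s)).mul_const Complex.I).const_add z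
      exact h1.comp_of_eq s h2 rfl
  · filter_upwards [Metric.ball_mem_nhds z hr0] with x hx
    exact aestronglyMeasurable_vertical hd
      (by linarith [(him x (Metric.ball_subset_ball (by linarith) hx)).1])
  · have hcont : ContinuousOn (deriv ψ) {z | 0 < z.im} := (hd.deriv hopen).continuousOn
    refine ((hcont.comp (s := Set.Ioi 0) (f := fun s : ℝ => z + s * Complex.I) (by fun_prop)
      fun s hs0 => ?_).mul continuousOn_const).aestronglyMeasurable measurableSet_Ioi
    have hs0 : (0 : ℝ) < s := hs0
    simp; linarith
  · filter_upwards [ae_restrict_mem measurableSet_Ioi] with s hs0 x hx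
    have hs0 : (0 : ℝ) < s := hs0
    rw [norm_mul, Complex.norm_I, mul_one, div_mul_eq_mul_div]
    refine Complex.norm_deriv_le_of_forall_mem_sphere_norm_le hr0 ?_ fun y hy => ?_
    · refine (hd.mono fun y hy => ?_).diffContOnCl
      have hy' := Metric.closure_ball_subset_closedBall hy
      rw [Metric.mem_closedBall, dist_eq_norm] at hy'
      have h1 := (Complex.abs_im_le_norm _).trans hy'
      have h2 := (him x (Metric.ball_subset_ball (by linarith) hx)).1
      simp [abs_le] at h1 ⊢
      linarith
    -- Moving y down by s returns it to the ball around z; hence y has height at least s, which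
    -- yields the factor exp(-cs).
    · have hmem : y - s * Complex.I ∈ Metric.ball z (2 * r) := by
        rw [Metric.mem_ball] at hx ⊢
        have h1 : dist (y - s * Complex.I) x = r := by
          rw [← hy, dist_eq_norm, dist_eq_norm]; congr 1; ring
        calc dist (y - s * Complex.I) z ≤ dist (y - s * Complex.I) x + dist x z :=
              dist_triangle _ _ _
          _ < 2 * r := by linarith
      have h2 := him _ hmem
      simp at h2
      refine (hb y (by linarith) h2.2).trans
        (mul_le_mul_of_nonneg_left (Real.exp_le_exp.mpr ?_) hC)
      nlinarith
  · exact (exp_neg_integrableOn_Ioi 0 hc).const_mul _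
  · filter_upwards [ae_restrict_mem measurableSet_Ioi] with s hs0 x hx
    have hx0 := (him x (Metric.ball_subset_ball (by linarith) hx)).1
    have h1 := hderiv x (by linarith) s hs0
    have h2 : HasDerivAt (fun x : ℂ => x + s * Complex.I) 1 x := (hasDerivAt_id x).add_const _
    simpa using (h1.comp x h2).mul_const Complex.I

/-- The vertical integrals from `i/(n+1)` tend to the integral over the imaginary axis. -/
theorem tendsto_vertInt_zero {ψ : ℂ → ℂ}
    (hi : IntegrableOn (fun s : ℝ => ψ (s * Complex.I) * Complex.I) (Set.Ioi 0)) :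
    Filter.Tendsto (fun n : ℕ => vertInt ψ ((1 / ((n : ℝ) + 1) : ℝ) * Complex.I)) Filter.atTop
      (nhds (∫ s in Set.Ioi (0 : ℝ), ψ (s * Complex.I) * Complex.I)) := by
  have hanti : Antitone fun n : ℕ => 1 / ((n : ℝ) + 1) := fun m n hmn =>
    one_div_le_one_div_of_le (by positivity) (by simpa using hmn)
  have hU : ⋃ n : ℕ, Set.Ioi (1 / ((n : ℝ) + 1)) = Set.Ioi 0 := by
    ext x
    simp only [Set.mem_iUnion, Set.mem_Ioi]
    refine ⟨fun ⟨n, hn⟩ => lt_trans (by positivity) hn, fun hx => exists_nat_one_div_lt hx⟩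
  have h := tendsto_setIntegral_of_monotone (μ := volume)
    (f := fun s : ℝ => ψ (s * Complex.I) * Complex.I)
    (s := fun n : ℕ => Set.Ioi (1 / ((n : ℝ) + 1))) (fun _ => measurableSet_Ioi)
    (fun m n hmn => Set.Ioi_subset_Ioi (hanti hmn)) (by rwa [hU])
  rw [hU] at h
  refine h.congr fun n => ?_
  rw [vertInt, ← (measurePreserving_add_left volume (1 / ((n : ℝ) + 1))).setIntegral_preimage_emb
    (measurableEmbedding_addLeft _), Set.preimage_const_add_Ioi, sub_self]
  refine setIntegral_congr_fun measurableSet_Ioi fun s _ => ?_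
  push_cast
  ring_nf

/-! ### Stokes' theorem on the standard fundamental domain -/

/-- The function `F` is real differentiable at `z`, with `∂F/∂z = a` and `∂F/∂z̄ = b`. -/
def HasWirtingerAt (F : ℂ → ℂ) (a b z : ℂ) : Prop :=
  HasFDerivAt F (a • (ContinuousLinearMap.id ℝ ℂ) + b • (Complex.conjCLE : ℂ →L[ℝ] ℂ)) z

theorem _root_.HasDerivAt.hasWirtingerAt {F : ℂ → ℂ} {a z : ℂ} (h : HasDerivAt F a z) :
    HasWirtingerAt F a 0 z := by
  refine (h.hasFDerivAt.restrictScalars ℝ).congr_fderiv ?_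
  ext v
  simp [mul_comm]

/-- Conjugation exchanges the two Wirtinger derivatives. This is the source of the nonzero surface
term in part (a). -/
theorem _root_.HasDerivAt.hasWirtingerAt_conj {F : ℂ → ℂ} {a z : ℂ} (h : HasDerivAt F a z) :
    HasWirtingerAt (fun z => conj (F z)) 0 (conj a) z := by
  refine ((Complex.conjCLE : ℂ →L[ℝ] ℂ).hasFDerivAt.comp z
    (h.hasFDerivAt.restrictScalars ℝ)).congr_fderiv ?_
  ext v
  simp [mul_comm]

theorem HasWirtingerAt.mul {F G : ℂ → ℂ} {a b c d z : ℂ} (hF : HasWirtingerAt F a b z)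
    (hG : HasWirtingerAt G c d z) :
    HasWirtingerAt (fun z => F z * G z) (F z * c + a * G z) (F z * d + b * G z) z := by
  refine (HasFDerivAt.mul hF hG).congr_fderiv ?_
  ext v
  simp
  ring

theorem HasWirtingerAt.const_mul {F : ℂ → ℂ} {a b z : ℂ} (hF : HasWirtingerAt F a b z) (c : ℂ) :
    HasWirtingerAt (fun z => c * F z) (c * a) (c * b) z := by
  simpa using (hasDerivAt_const z c).hasWirtingerAt.mul hF

theorem HasWirtingerAt.sum {ι : Type*} (s : Finset ι) {F : ι → ℂ → ℂ} {a b : ι → ℂ} {z : ℂ}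
    (h : ∀ i ∈ s, HasWirtingerAt (F i) (a i) (b i) z) :
    HasWirtingerAt (fun z => ∑ i ∈ s, F i z) (∑ i ∈ s, a i) (∑ i ∈ s, b i) z := by
  refine (HasFDerivAt.fun_sum h).congr_fderiv ?_
  ext v
  simp [Finset.sum_add_distrib, Finset.sum_mul]

/-! ### The fundamental domain as a half-strip over the unit arc -/

/-- The height of the unit circle above `x`. -/
def arcHeight (x : ℝ) : ℝ := √(1 - x ^ 2)

/-- The point of the unit circle above `x`. -/
def arc (x : ℝ) : ℂ := x + arcHeight x * Complex.I

/-- The derivative of `arc`. -/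
def arcDeriv (x : ℝ) : ℂ := 1 - x / arcHeight x * Complex.I

theorem arc_re (x : ℝ) : (arc x).re = x := by simp [arc]

theorem arc_im (x : ℝ) : (arc x).im = arcHeight x := by simp [arc]

theorem arcHeight_pos {x : ℝ} (hx : |x| < 1) : 0 < arcHeight x := by
  refine Real.sqrt_pos.mpr ?_
  have := (sq_lt_one_iff_abs_lt_one x).mpr hx
  linarith

theorem arcHeight_sq {x : ℝ} (hx : |x| < 1) : arcHeight x ^ 2 = 1 - x ^ 2 := by
  refine Real.sq_sqrt ?_
  have := (sq_lt_one_iff_abs_lt_one x).mpr hx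
  linarith

theorem half_le_arcHeight {x : ℝ} (hx : |x| ≤ 1 / 2) : 1 / 2 ≤ arcHeight x := by
  refine Real.le_sqrt_of_sq_le ?_
  have := sq_le_sq' (abs_le.mp hx).1 (abs_le.mp hx).2
  linarith

theorem continuous_arcHeight : Continuous arcHeight := by
  unfold arcHeight
  fun_prop

theorem arcHeight_neg (x : ℝ) : arcHeight (-x) = arcHeight x := by simp [arcHeight]

theorem hasDerivAt_arcHeight {x : ℝ} (hx : |x| < 1) :
    HasDerivAt arcHeight (-(x / arcHeight x)) x := by
  have h1 : HasDerivAt (fun x : ℝ => 1 - x ^ 2) (-(2 * x)) x := by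
    simpa using ((hasDerivAt_pow 2 x).const_sub 1)
  have h0 : 1 - x ^ 2 ≠ 0 := by
    have := (sq_lt_one_iff_abs_lt_one x).mpr hx
    linarith
  refine (h1.sqrt h0).congr_deriv ?_
  have := (arcHeight_pos hx).ne'
  change -(2 * x) / (2 * arcHeight x) = _
  field_simp

theorem hasDerivAt_arc {x : ℝ} (hx : |x| < 1) : HasDerivAt arc (arcDeriv x) x := by
  have h1 : HasDerivAt (fun x : ℝ => (x : ℂ)) 1 x := Complex.ofRealCLM.hasDerivAt
  have h2 := ((hasDerivAt_arcHeight hx).ofReal_comp.mul_const Complex.I)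
  refine (h1.add h2).congr_deriv ?_
  rw [arcDeriv]
  push_cast
  ring

theorem differentiableAt_arcDeriv {x : ℝ} (hx : |x| < 1) : DifferentiableAt ℝ arcDeriv x := by
  have h : DifferentiableAt ℝ (fun x : ℝ => ((x / arcHeight x : ℝ) : ℂ)) x :=
    Complex.ofRealCLM.differentiableAt.comp x
      (differentiableAt_id.div (hasDerivAt_arcHeight hx).differentiableAt (arcHeight_pos hx).ne')
  have h2 := (h.mul_const Complex.I).const_sub 1
  refine h2.congr_of_eventuallyEq (Filter.Eventually.of_forall fun y => ?_)
  simp [arcDeriv]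

theorem abs_lt_one_of_abs_le_half {x : ℝ} (hx : |x| ≤ 1 / 2) : |x| < 1 := by linarith

theorem norm_arcDeriv_le {x : ℝ} (hx : |x| ≤ 1 / 2) : ‖arcDeriv x‖ ≤ 2 := by
  have hh := half_le_arcHeight hx
  have h1 : ‖(x : ℂ) / arcHeight x * Complex.I‖ ≤ 1 := by
    rw [norm_mul, norm_div, Complex.norm_I, mul_one, Complex.norm_real, Complex.norm_real,
      Real.norm_eq_abs, Real.norm_eq_abs, abs_of_pos (by linarith : 0 < arcHeight x)]
    rw [div_le_one (by linarith)]
    linarith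
  calc ‖arcDeriv x‖ ≤ ‖(1 : ℂ)‖ + ‖(x : ℂ) / arcHeight x * Complex.I‖ := norm_sub_le _ _
    _ ≤ 2 := by rw [norm_one]; linarith

/-- The standard fundamental domain in the coordinates `(x, s)`, `s` being the height above the
unit circle. -/
def arcChart (p : ℝ × ℝ) : ℂ := arc p.1 + p.2 * Complex.I

theorem arcChart_im (p : ℝ × ℝ) : (arcChart p).im = arcHeight p.1 + p.2 := by
  simp [arcChart, arc_im]

theorem arcChart_re (p : ℝ × ℝ) : (arcChart p).re = p.1 := by simp [arcChart, arc_re]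

theorem continuous_arcChart : Continuous arcChart := by
  have := continuous_arcHeight
  unfold arcChart arc
  fun_prop

theorem hasFDerivAt_arcChart {p : ℝ × ℝ} (hp : |p.1| < 1) :
    HasFDerivAt arcChart ((ContinuousLinearMap.fst ℝ ℝ ℝ).smulRight (arcDeriv p.1) +
      (ContinuousLinearMap.snd ℝ ℝ ℝ).smulRight Complex.I) p := by
  have h1 : HasFDerivAt (fun p : ℝ × ℝ => arc p.1) _ p :=
    (hasDerivAt_arc hp).hasFDerivAt.comp p hasFDerivAt_fst
  have h2 : HasFDerivAt (fun p : ℝ × ℝ => (p.2 : ℂ) * Complex.I) _ p :=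
    (Complex.ofRealCLM.hasFDerivAt.comp p hasFDerivAt_snd).mul_const Complex.I
  refine (h1.add h2).congr_fderiv ?_
  ext <;> simp

/-- The coordinates `(x, s)` as a measurable equivalence. -/
def arcEquiv : ℝ × ℝ ≃ᵐ ℂ where
  toFun := arcChart
  invFun z := (z.re, z.im - arcHeight z.re)
  left_inv p := by simp [arcChart_re, arcChart_im]
  right_inv z := by apply Complex.ext <;> simp [arcChart_re, arcChart_im]
  measurable_toFun := continuous_arcChart.measurable
  measurable_invFun := by
    have := continuous_arcHeight.measurable
    exact Complex.measurable_re.prodMk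
      (Complex.measurable_im.sub (this.comp Complex.measurable_re))

/-- The chart is a shear: each vertical line is translated by `arcHeight`. -/
theorem measurePreserving_arcEquiv : MeasurePreserving arcEquiv := by
  have h1 : MeasurePreserving (fun p : ℝ × ℝ => (p.1, arcHeight p.1 + p.2)) :=
    (MeasurePreserving.id volume).skew_product (g := fun x s => arcHeight x + s)
      (by have := continuous_arcHeight.measurable; fun_prop)
      (Filter.Eventually.of_forall fun x => map_add_left_eq_self volume (arcHeight x))
  have h2 := Complex.volume_preserving_equiv_real_prod.symm.comp h1
  convert h2 using 1
  ext p
  apply Complex.ext <;>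
    simp [arcEquiv, arcChart_re, arcChart_im, Complex.measurableEquivRealProd]

/-- The standard fundamental domain, as a set of complex numbers. -/
def fdSet : Set ℂ := {z | 0 < z.im ∧ 1 ≤ ‖z‖ ∧ |z.re| ≤ 1 / 2}

/-- Straightening the arc makes the domain a product, so the divergence theorem for rectangles
applies. -/
theorem preimage_fdSet : arcEquiv ⁻¹' fdSet = Set.Icc (-(1 / 2)) (1 / 2) ×ˢ Set.Ici 0 := by
  ext ⟨x, s⟩
  change (0 < (arcChart (x, s)).im ∧ 1 ≤ ‖arcChart (x, s)‖ ∧ |(arcChart (x, s)).re| ≤ 1 / 2) ↔ _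
  simp only [arcChart_im, arcChart_re, Set.mem_prod, Set.mem_Icc, Set.mem_Ici, ← abs_le]
  have hn : 1 ≤ ‖arcChart (x, s)‖ ↔ 1 ≤ x ^ 2 + (arcHeight x + s) ^ 2 := by
    rw [← one_le_sq_iff₀ (norm_nonneg _), Complex.sq_norm, Complex.normSq_apply, arcChart_re,
      arcChart_im, sq, sq]
  rw [hn]
  constructor
  · rintro ⟨h1, h2, h3⟩
    refine ⟨h3, ?_⟩
    have h4 := arcHeight_sq (abs_lt_one_of_abs_le_half h3)
    have h5 := arcHeight_pos (abs_lt_one_of_abs_le_half h3)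
    have h6 : arcHeight x ^ 2 ≤ (arcHeight x + s) ^ 2 := by linarith
    have := (sq_le_sq₀ h5.le h1.le).mp h6
    linarith
  · rintro ⟨h3, h1⟩
    have h4 := arcHeight_sq (abs_lt_one_of_abs_le_half h3)
    have h5 := arcHeight_pos (abs_lt_one_of_abs_le_half h3)
    refine ⟨by linarith, ?_, h3⟩
    nlinarith

theorem arcChart_im_pos {p : ℝ × ℝ} (hp : |p.1| < 1) (hp' : 0 ≤ p.2) : 0 < (arcChart p).im := by
  rw [arcChart_im]
  have := arcHeight_pos hp
  linarith

theorem integrableOn_arcChart {b : ℂ → ℂ} (hc : ContinuousOn b {z | 0 < z.im})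
    (hb : StripDecay b) :
    IntegrableOn (fun p => b (arcChart p)) (Set.Icc (-(1 / 2)) (1 / 2) ×ˢ Set.Ici 0) := by
  obtain ⟨C, hC, c, hc0, hbd⟩ := hb (1 / 2) (by norm_num) (1 / 2)
  have hI : IntegrableOn (fun p : ℝ × ℝ => C * Real.exp (-c * p.2))
      (Set.Icc (-(1 / 2)) (1 / 2) ×ˢ Set.Ici 0) := by
    rw [IntegrableOn, Measure.volume_eq_prod, ← Measure.prod_restrict]
    refine Integrable.mul_prod (f := fun _ : ℝ => C) (g := fun s => Real.exp (-c * s))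
      (integrableOn_const (by simp)) ?_
    exact (integrableOn_Ici_iff_integrableOn_Ioi).mpr (exp_neg_integrableOn_Ioi 0 hc0)
  have hm : MeasurableSet (Set.Icc (-(1 / 2) : ℝ) (1 / 2) ×ˢ Set.Ici (0 : ℝ)) :=
    measurableSet_Icc.prod measurableSet_Ici
  refine Integrable.mono' hI (ContinuousOn.aestronglyMeasurable ?_ hm) ?_
  · refine hc.comp continuous_arcChart.continuousOn fun p hp => ?_
    exact arcChart_im_pos (abs_lt_one_of_abs_le_half (abs_le.mpr hp.1)) hp.2
  · filter_upwards [ae_restrict_mem hm] with p hp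
    have hp2 : 0 ≤ p.2 := hp.2
    have hp1 : |p.1| ≤ 1 / 2 := abs_le.mpr hp.1
    have h1 := half_le_arcHeight hp1
    refine (hbd _ (by rw [arcChart_im]; linarith) (by rwa [arcChart_re])).trans
      (mul_le_mul_of_nonneg_left (Real.exp_le_exp.mpr ?_) hC)
    rw [arcChart_im]
    nlinarith

theorem integrableOn_fdSet {b : ℂ → ℂ} (hc : ContinuousOn b {z | 0 < z.im}) (hb : StripDecay b) :
    IntegrableOn b fdSet := by
  rw [← measurePreserving_arcEquiv.integrableOn_comp_preimage arcEquiv.measurableEmbedding,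
    preimage_fdSet]
  exact integrableOn_arcChart hc hb

theorem continuousOn_arcDeriv : ContinuousOn arcDeriv (Set.Icc (-(1 / 2)) (1 / 2)) := fun _ hx =>
  (differentiableAt_arcDeriv
    (abs_lt_one_of_abs_le_half (abs_le.mpr hx))).continuousAt.continuousWithinAt

/-- Stokes' theorem on the truncated fundamental domain. -/
theorem stokes_truncated {W a b : ℂ → ℂ} (hW : ∀ z, 0 < z.im → HasWirtingerAt W (a z) (b z) z)
    (hc : ContinuousOn b {z | 0 < z.im}) (hT : ∀ z, 0 < z.im → W (z + 1) = W z)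
    {N : ℝ} (hN : 0 ≤ N) :
    (∫ x in (-(1 / 2) : ℝ)..(1 / 2), ∫ s in (0 : ℝ)..N, 2 * Complex.I * b (arcChart (x, s))) =
      (∫ x in (-(1 / 2) : ℝ)..(1 / 2), arcDeriv x * W (arcChart (x, 0))) -
        ∫ x in (-(1 / 2) : ℝ)..(1 / 2), arcDeriv x * W (arcChart (x, N)) := by
  have hpos : ∀ p ∈ Set.Icc (-(1 / 2) : ℝ) (1 / 2) ×ˢ Set.Icc 0 N,
      |p.1| < 1 ∧ 0 < (arcChart p).im := fun p hp =>
    have h := abs_lt_one_of_abs_le_half (abs_le.mpr hp.1)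
    ⟨h, arcChart_im_pos h hp.2.1⟩
  have hWφ : ∀ p ∈ Set.Icc (-(1 / 2) : ℝ) (1 / 2) ×ˢ Set.Icc 0 N,
      HasFDerivAt (fun p => W (arcChart p)) _ p := fun p hp =>
    HasFDerivAt.comp p (hW _ (hpos p hp).2) (hasFDerivAt_arcChart (hpos p hp).1)
  have hf : ∀ p ∈ Set.Icc (-(1 / 2) : ℝ) (1 / 2) ×ˢ Set.Icc 0 N,
      HasFDerivAt (fun p => Complex.I * W (arcChart p)) _ p := fun p hp =>
    (hWφ p hp).const_mul Complex.I
  have hm : ∀ p ∈ Set.Icc (-(1 / 2) : ℝ) (1 / 2) ×ˢ Set.Icc 0 N,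
      HasFDerivAt (fun p : ℝ × ℝ => -arcDeriv p.1) _ p := fun p hp =>
    ((differentiableAt_arcDeriv (hpos p hp).1).hasDerivAt.hasFDerivAt.comp p hasFDerivAt_fst).neg
  have hg : ∀ p ∈ Set.Icc (-(1 / 2) : ℝ) (1 / 2) ×ˢ Set.Icc 0 N,
      HasFDerivAt (fun p : ℝ × ℝ => -arcDeriv p.1 * W (arcChart p)) _ p := fun p hp =>
    (hm p hp).mul (hWφ p hp)
  -- In the chart, W dz = W (arc' dx + i ds), which dictates this vector field. In its divergence
  -- the ∂W/∂z terms cancel and the rest is i b (arc' + conj arc') = 2ib, as arc' has real part 1.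
  have hdiv : ∀ p ∈ Set.Icc (-(1 / 2) : ℝ) (1 / 2) ×ˢ Set.Icc 0 N,
      fderiv ℝ (fun p => Complex.I * W (arcChart p)) p (1, 0) +
        fderiv ℝ (fun p : ℝ × ℝ => -arcDeriv p.1 * W (arcChart p)) p (0, 1) =
      2 * Complex.I * b (arcChart p) := by
    intro p hp
    rw [(hf p hp).fderiv, (hg p hp).fderiv]
    simp [arcDeriv]
    ring
  have hsub : Set.Ioo (-(1 / 2) : ℝ) (1 / 2) ×ˢ Set.Ioo 0 N ⊆ Set.Icc (-(1 / 2)) (1 / 2) ×ˢ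
      Set.Icc 0 N := Set.prod_mono Set.Ioo_subset_Icc_self Set.Ioo_subset_Icc_self
  have hle : (-(1 / 2) : ℝ) ≤ 1 / 2 := by norm_num
  have main := integral2_divergence_prod_of_hasFDerivAt
    (fun p => Complex.I * W (arcChart p)) (fun p : ℝ × ℝ => -arcDeriv p.1 * W (arcChart p))
    (fderiv ℝ (fun p => Complex.I * W (arcChart p)))
    (fderiv ℝ (fun p : ℝ × ℝ => -arcDeriv p.1 * W (arcChart p)))
    (-(1 / 2)) 0 (1 / 2) N ?_ ?_ ?_ ?_ ?_
  -- The two vertical sides differ by the translation z ↦ z + 1, so periodicity cancels their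
  -- contributions.
  · have hside : ∀ y : ℝ, y ∈ Set.uIcc 0 N →
        Complex.I * W (arcChart (1 / 2, y)) = Complex.I * W (arcChart (-(1 / 2), y)) := by
      intro y hy
      rw [Set.uIcc_of_le hN] at hy
      rw [← hT _ (hpos (-(1 / 2), y) ⟨⟨le_rfl, hle⟩, hy⟩).2]
      congr 2
      simp only [arcChart, arc, arcHeight_neg]
      push_cast
      ring
    rw [intervalIntegral.integral_congr hside, add_sub_cancel_right] at main
    simp only [neg_mul, intervalIntegral.integral_neg, sub_neg_eq_add] at main
    rw [sub_eq_neg_add, ← main]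
    refine intervalIntegral.integral_congr fun x hx => ?_
    refine intervalIntegral.integral_congr fun s hs => ?_
    rw [Set.uIcc_of_le hle] at hx
    rw [Set.uIcc_of_le hN] at hs
    rw [← hdiv (x, s) ⟨hx, hs⟩]
    simp only [neg_mul]
  all_goals simp only [Set.uIcc_of_le hle, Set.uIcc_of_le hN, min_eq_left hle, max_eq_right hle,
    min_eq_left hN, max_eq_right hN]
  · exact fun p hp => (hf p hp).continuousAt.continuousWithinAt
  · exact fun p hp => (hg p hp).continuousAt.continuousWithinAt
  · exact fun p hp => (hf p (hsub hp)).differentiableAt.hasFDerivAt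
  · exact fun p hp => (hg p (hsub hp)).differentiableAt.hasFDerivAt
  · refine IntegrableOn.congr_fun (f := fun p => 2 * Complex.I * b (arcChart p)) ?_
      (fun p hp => (hdiv p hp).symm) (measurableSet_Icc.prod measurableSet_Icc)
    refine ContinuousOn.integrableOn_compact (isCompact_Icc.prod isCompact_Icc) ?_
    exact continuousOn_const.mul (hc.comp continuous_arcChart.continuousOn
      fun p hp => (hpos p hp).2)

/-- Stokes' theorem on the standard fundamental domain, for a form `W(z) dz` with periodic `W` that
decays exponentially at `i∞`. -/
theorem stokes_fdSet {W a b : ℂ → ℂ} (hW : ∀ z, 0 < z.im → HasWirtingerAt W (a z) (b z) z)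
    (hc : ContinuousOn b {z | 0 < z.im}) (hT : ∀ z, 0 < z.im → W (z + 1) = W z)
    (dW : StripDecay W) (db : StripDecay b) :
    ∫ z in fdSet, 2 * Complex.I * b z =
      ∫ x in (-(1 / 2) : ℝ)..(1 / 2), W (arc x) * arcDeriv x := by
  have hle : (-(1 / 2) : ℝ) ≤ 1 / 2 := by norm_num
  have hint : IntegrableOn (fun p => 2 * Complex.I * b (arcChart p))
      (Set.Icc (-(1 / 2)) (1 / 2) ×ˢ Set.Ici 0) := (integrableOn_arcChart hc db).const_mul _
  have hae : (Set.Ioc (-(1 / 2) : ℝ) (1 / 2) ×ˢ Set.Ioi (0 : ℝ) : Set (ℝ × ℝ)) =ᵐ[volume]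
      (Set.Icc (-(1 / 2)) (1 / 2) ×ˢ Set.Ici 0 : Set (ℝ × ℝ)) :=
    Measure.set_prod_ae_eq Ioc_ae_eq_Icc Ioi_ae_eq_Ici
  have hint' := hint.congr_set_ae hae
  have hLHS : ∫ z in fdSet, 2 * Complex.I * b z =
      ∫ p in Set.Ioc (-(1 / 2) : ℝ) (1 / 2) ×ˢ Set.Ioi (0 : ℝ),
        2 * Complex.I * b (arcChart p) := by
    rw [← measurePreserving_arcEquiv.setIntegral_preimage_emb arcEquiv.measurableEmbedding,
      preimage_fdSet, setIntegral_congr_set hae]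
    rfl
  have hU : ⋃ n : ℕ, Set.Ioc (-(1 / 2) : ℝ) (1 / 2) ×ˢ Set.Ioc (0 : ℝ) n =
      Set.Ioc (-(1 / 2) : ℝ) (1 / 2) ×ˢ Set.Ioi (0 : ℝ) := by
    rw [← Set.prod_iUnion, Set.iUnion_Ioc_eq_Ioi_self_iff.mpr fun x _ => exists_nat_ge x]
  have hlim := tendsto_setIntegral_of_monotone (μ := volume)
    (f := fun p => 2 * Complex.I * b (arcChart p))
    (s := fun n : ℕ => Set.Ioc (-(1 / 2) : ℝ) (1 / 2) ×ˢ Set.Ioc (0 : ℝ) n)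
    (fun _ => measurableSet_Ioc.prod measurableSet_Ioc)
    (fun m n hmn => Set.prod_mono le_rfl (Set.Ioc_subset_Ioc_right (by exact_mod_cast hmn)))
    (by rwa [hU])
  rw [hU, ← hLHS] at hlim
  refine tendsto_nhds_unique hlim ?_
  have heq : ∀ n : ℕ, ∫ p in Set.Ioc (-(1 / 2) : ℝ) (1 / 2) ×ˢ Set.Ioc (0 : ℝ) n,
      2 * Complex.I * b (arcChart p) =
      (∫ x in (-(1 / 2) : ℝ)..(1 / 2), arcDeriv x * W (arcChart (x, 0))) -
        ∫ x in (-(1 / 2) : ℝ)..(1 / 2), arcDeriv x * W (arcChart (x, n)) := by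
    intro n
    rw [← stokes_truncated hW hc hT n.cast_nonneg, Measure.volume_eq_prod, setIntegral_prod,
      intervalIntegral.integral_of_le hle]
    · simp only [intervalIntegral.integral_of_le (Nat.cast_nonneg (α := ℝ) n)]
    · exact hint'.mono_set (Set.prod_mono le_rfl Set.Ioc_subset_Ioi_self)
  simp only [heq]
  have h0 : ∫ x in (-(1 / 2) : ℝ)..(1 / 2), W (arc x) * arcDeriv x =
      (∫ x in (-(1 / 2) : ℝ)..(1 / 2), arcDeriv x * W (arcChart (x, 0))) - 0 := by
    rw [sub_zero]
    refine intervalIntegral.integral_congr fun x _ => ?_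
    simp [arcChart, mul_comm]
  rw [h0]
  -- What remains is the top edge at height n above the arc, which tends to zero by strip decay.
  refine tendsto_const_nhds.sub ?_
  obtain ⟨C, hC, c, hc0, hbd⟩ := dW (1 / 2) (by norm_num) (1 / 2)
  refine squeeze_zero_norm (a := fun n : ℕ => 2 * (C * Real.exp (-c * n))) (fun n => ?_) ?_
  · have := intervalIntegral.norm_integral_le_of_norm_le_const (a := (-(1 / 2) : ℝ)) (b := 1 / 2)
      (C := 2 * (C * Real.exp (-c * n))) (f := fun x => arcDeriv x * W (arcChart (x, n))) ?_
    · refine this.trans (le_of_eq ?_)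
      norm_num
    · intro x hx
      rw [Set.uIoc_of_le hle] at hx
      have hx' : |x| ≤ 1 / 2 := abs_le.mpr ⟨hx.1.le, hx.2⟩
      have h1 := half_le_arcHeight hx'
      have hn : (0 : ℝ) ≤ n := n.cast_nonneg
      rw [norm_mul]
      refine mul_le_mul (norm_arcDeriv_le hx') ?_ (norm_nonneg _) zero_le_two
      refine (hbd _ (by rw [arcChart_im]; linarith) (by rwa [arcChart_re])).trans
        (mul_le_mul_of_nonneg_left (Real.exp_le_exp.mpr ?_) hC)
      rw [arcChart_im]
      nlinarith
  · have : Filter.Tendsto (fun n : ℕ => -c * (n : ℝ)) Filter.atTop Filter.atBot :=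
      tendsto_natCast_atTop_atTop.const_mul_atTop_of_neg (by linarith)
    simpa using ((Real.tendsto_exp_atBot.comp this).const_mul C).const_mul 2

section

open scoped Pointwise

/-! ### Fundamental domains -/

instance : Countable SL(2, ℤ) :=
  Function.Injective.countable (f := fun g : SL(2, ℤ) => fun i j => g i j) fun g h hgh => by
    ext i j
    exact congrFun (congrFun hgh i) j

instance : MeasurableConstSMul SL(2, ℤ) ℍ :=
  ⟨fun g => (continuous_const_smul (g : GL (Fin 2) ℝ)).measurable⟩

instance : SMulInvariantMeasure SL(2, ℤ) ℍ volume :=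
  ⟨fun g _ hs => SMulInvariantMeasure.measure_preimage_smul (g : GL (Fin 2) ℝ) hs⟩

variable {Γ : Subgroup SL(2, ℤ)}

theorem exists_of_mem_projGroup (e : projGroup Γ) : ∃ γ ∈ Γ, ∀ z : ℍ, e • z = γ • z := by
  obtain ⟨_, γ, hγ, rfl⟩ := e
  exact ⟨γ, hγ, fun _ => rfl⟩

instance : Countable (projGroup Γ) := by
  have : Countable (Γ.map (MulAction.toPermHom SL(2, ℤ) ℍ) : Set (Equiv.Perm ℍ)) := by
    rw [Subgroup.coe_map]
    exact (Set.to_countable _).image _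
  exact this

instance : MeasurableConstSMul (projGroup Γ) ℍ :=
  ⟨fun e => by
    obtain ⟨γ, -, h⟩ := exists_of_mem_projGroup e
    rw [funext h]
    exact measurable_const_smul γ⟩

instance : SMulInvariantMeasure (projGroup Γ) ℍ volume :=
  ⟨fun e s hs => by
    obtain ⟨γ, -, h⟩ := exists_of_mem_projGroup e
    rw [funext h]
    exact SMulInvariantMeasure.measure_preimage_smul γ hs⟩

/-! ### Tiling by translates of the standard domain, up to null sets -/

theorem volume_eq_zero_of_image {s : Set ℍ} (h : volume ((↑) '' s : Set ℂ) = 0) : volume s = 0 := by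
  rw [volume_eq_lintegral]
  exact setLIntegral_measure_zero _ _ h

theorem volume_re_eq (c : ℝ) : volume {z : ℂ | z.re = c} = 0 := by
  have h : {z : ℂ | z.re = c} = Complex.measurableEquivRealProd ⁻¹' ({c} ×ˢ Set.univ) := by
    ext z
    simp [Complex.measurableEquivRealProd]
  rw [h, Complex.volume_preserving_equiv_real_prod.measure_preimage_equiv, Measure.volume_eq_prod,
    Measure.prod_prod]
  simp

theorem volume_fd_diff_fdo : volume (ModularGroup.fd \ ModularGroup.fdo) = 0 := by
  refine volume_eq_zero_of_image (measure_mono_null (t := Metric.sphere 0 1 ∪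
    ({z : ℂ | z.re = 1 / 2} ∪ {z : ℂ | z.re = -(1 / 2)})) ?_ ?_)
  · rintro _ ⟨z, ⟨⟨h1, h2⟩, h3⟩, rfl⟩
    by_cases h4 : 1 < Complex.normSq (z : ℂ)
    · right
      have h5 : ¬ |z.re| < 1 / 2 := fun h => h3 ⟨h4, h⟩
      exact eq_or_eq_neg_of_abs_eq (le_antisymm h2 (not_lt.mp h5))
    · left
      have h5 : ‖(z : ℂ)‖ ^ 2 = 1 := by
        rw [Complex.sq_norm]
        exact le_antisymm (not_lt.mp h4) h1
      rw [pow_eq_one_iff_of_nonneg (norm_nonneg _) two_ne_zero] at h5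
      simpa using h5
  · rw [measure_union_null_iff, measure_union_null_iff]
    exact ⟨Measure.addHaar_sphere _ _ _, volume_re_eq _, volume_re_eq _⟩

/-- An interior point of one tile lies in another only if the two group elements agree up to sign.
The overlap is therefore contained in a translate of the null boundary. -/
theorem aedisjoint_smul_fd {g h : SL(2, ℤ)} (hgh : g ≠ h) (hgh' : g ≠ -h) :
    AEDisjoint volume (g • ModularGroup.fd) (h • ModularGroup.fd) := by
  have hsub : g • ModularGroup.fd ∩ h • ModularGroup.fd ⊆
      h • (ModularGroup.fd \ ModularGroup.fdo) := by
    rintro z ⟨hg, hh⟩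
    rw [Set.mem_smul_set_iff_inv_smul_mem] at hg hh ⊢
    refine ⟨hh, fun hzo => ?_⟩
    have h1 : (g⁻¹ * h) • h⁻¹ • z ∈ ModularGroup.fd := by rwa [mul_smul, smul_inv_smul]
    rcases ModularGroup.eq_one_or_neg_one_of_mem_fdo_mem_fd hzo h1 with h2 | h2
    · exact hgh (inv_mul_eq_one.mp h2)
    · refine hgh' ?_
      have : h = g * -1 := by rw [← h2, mul_inv_cancel_left]
      rw [this]
      simp
  refine measure_mono_null hsub ?_
  rw [measure_smul, volume_fd_diff_fdo]

theorem measurableSet_smul_fd (g : SL(2, ℤ)) : MeasurableSet (g • ModularGroup.fd) :=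
  ModularGroup.isClosed_fd.measurableSet.const_smul g

theorem pairwise_aedisjoint_out_smul_fd :
    Pairwise (Function.onFun (AEDisjoint (volume : Measure ℍ))
      fun q : Quotient (QuotientGroup.rightRel (plusMinus Γ)) => q.out • ModularGroup.fd) := by
  intro q q' hqq'
  refine aedisjoint_smul_fd (fun h => hqq' (Quotient.out_injective h)) fun h => hqq' ?_
  rw [← q.out_eq, ← q'.out_eq]
  refine (Quotient.sound (QuotientGroup.rightRel_apply.mpr ?_)).symm
  rw [h]
  exact .inr (by simp)

/-- The union of translates of the standard fundamental domain of `SL₂(ℤ)` by coset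
representatives is a fundamental domain. -/
theorem isFundamentalDomain_iUnion [Γ.FiniteIndex] :
    IsFundamentalDomain (projGroup Γ)
      (⋃ q : Quotient (QuotientGroup.rightRel (plusMinus Γ)), q.out • ModularGroup.fd) volume := by
  refine ⟨?_, ?_, ?_⟩
  · exact (MeasurableSet.iUnion fun q => measurableSet_smul_fd _).nullMeasurableSet
  · refine Filter.Eventually.of_forall fun z => ?_
    obtain ⟨g, hg⟩ := ModularGroup.exists_smul_mem_fd z
    -- With gz in the standard domain, z = g⁻¹(gz), so the coset of g⁻¹ selects the tile; its
    -- representative differs from g⁻¹ by an element of ±Γ.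
    set q : Quotient (QuotientGroup.rightRel (plusMinus Γ)) := Quotient.mk _ g⁻¹ with hq
    have hz : g⁻¹ • (g • z) = z := inv_smul_smul g z
    have hrel : q.out * g ∈ plusMinus Γ := by
      have : (QuotientGroup.rightRel (plusMinus Γ)) g⁻¹ q.out :=
        Quotient.exact (by rw [q.out_eq, hq])
      simpa using QuotientGroup.rightRel_apply.mp this
    obtain ⟨γ, hγ, hγz⟩ : ∃ γ ∈ Γ, γ • z = q.out • g • z := by
      rcases hrel with h | h
      · exact ⟨_, h, mul_smul _ _ _⟩
      · exact ⟨_, h, by rw [ModularGroup.SL_neg_smul, mul_smul]⟩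
    refine ⟨⟨_, Subgroup.mem_map_of_mem _ hγ⟩, Set.mem_iUnion.mpr ⟨q, ?_⟩⟩
    change γ • z ∈ _
    rw [hγz]
    exact Set.smul_mem_smul_set hg
  · intro e e' hee'
    obtain ⟨γ, hγ, h⟩ := exists_of_mem_projGroup e
    obtain ⟨γ', hγ', h'⟩ := exists_of_mem_projGroup e'
    have hset : ∀ s : Set ℍ, e • s = γ • s := fun s => Set.image_congr fun z _ => h z
    have hset' : ∀ s : Set ℍ, e' • s = γ' • s := fun s => Set.image_congr fun z _ => h' z
    change AEDisjoint volume (e • _) (e' • _)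
    rw [hset, hset', Set.smul_set_iUnion, Set.smul_set_iUnion, AEDisjoint.iUnion_left_iff]
    intro q
    rw [AEDisjoint.iUnion_right_iff]
    intro q'
    rw [smul_smul, smul_smul]
    have hne : ¬ ∀ z : ℍ, γ • z = γ' • z := fun hz =>
      hee' (Subtype.ext (Equiv.ext fun z => (h z).trans ((hz z).trans (h' z).symm)))
    -- If two translated tiles coincide up to sign, the cosets are equal; cancelling the
    -- representative then makes γ and γ' act alike, against `hne`.
    have hqq : ∀ δ ∈ plusMinus Γ, q.out = δ * q'.out → q = q' := by
      intro δ hδ hδq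
      rw [← q.out_eq, ← q'.out_eq]
      refine (Quotient.sound (QuotientGroup.rightRel_apply.mpr ?_)).symm
      rwa [hδq, mul_inv_cancel_right]
    refine aedisjoint_smul_fd (fun heq => ?_) fun heq => ?_
    · have := hqq (γ⁻¹ * γ') (.inl (mul_mem (inv_mem hγ) hγ'))
        (by rw [mul_assoc, ← heq, inv_mul_cancel_left])
      subst this
      exact hne fun z => by rw [mul_right_cancel heq]
    · have := hqq (-(γ⁻¹ * γ')) (.inr (by simpa using mul_mem (inv_mem hγ) hγ'))
        (by rw [neg_mul, mul_assoc, ← mul_neg, ← heq, inv_mul_cancel_left])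
      subst this
      rw [← neg_mul] at heq
      exact hne fun z => by rw [mul_right_cancel heq, ModularGroup.SL_neg_smul]

/-! ### Passing between hyperbolic integrals on ℍ and Lebesgue integrals on ℂ -/

theorem coe_image_fd : ((↑) '' ModularGroup.fd : Set ℂ) = fdSet := ModularGroup.coe_fd

theorem preimage_coe_fdSet : ((↑) : ℍ → ℂ) ⁻¹' fdSet = ModularGroup.fd := by
  rw [← coe_image_fd, Set.preimage_image_eq _ UpperHalfPlane.coe_injective]

theorem fdSet_subset_range : fdSet ⊆ Set.range ((↑) : ℍ → ℂ) := by
  rw [← coe_image_fd]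
  exact Set.image_subset_range _ _

theorem measurePreserving_coe : MeasurePreserving ((↑) : ℍ → ℂ) (volume.comap UpperHalfPlane.coe)
    (volume.restrict (Set.range UpperHalfPlane.coe)) :=
  ⟨measurable_coe, by rw [measurableEmbedding_coe.map_comap]⟩

theorem measurable_density :
    Measurable fun z : ℍ => ((1 / NNReal.mk z.im z.im_pos.le : NNReal) ^ 2) := by
  refine Measurable.pow_const (Measurable.const_div ?_ _) _
  exact (continuous_im.subtype_mk _).measurable

theorem density_smul (φ : ℍ → ℂ) :
    (fun z : ℍ => ((1 / NNReal.mk z.im z.im_pos.le : NNReal) ^ 2) • φ z) =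
      (fun z : ℂ => ((z.im : ℂ) ^ 2)⁻¹ * φ (ofComplex z)) ∘ ((↑) : ℍ → ℂ) := by
  ext z
  rw [NNReal.smul_def, Function.comp_apply, ofComplex_apply, Complex.real_smul]
  congr 1
  push_cast
  simp

theorem integrableOn_fd {φ : ℍ → ℂ}
    (h : IntegrableOn (fun z : ℂ => ((z.im : ℂ) ^ 2)⁻¹ * φ (ofComplex z)) fdSet) :
    IntegrableOn φ ModularGroup.fd := by
  rw [IntegrableOn, volume_def, restrict_withDensity ModularGroup.isClosed_fd.measurableSet,
    integrable_withDensity_iff_integrable_smul measurable_density, density_smul]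
  change IntegrableOn _ _ _
  rw [← preimage_coe_fdSet, measurePreserving_coe.integrableOn_comp_preimage
    measurableEmbedding_coe, IntegrableOn, Measure.restrict_restrict_of_subset fdSet_subset_range]
  exact h

theorem setIntegral_fd (φ : ℍ → ℂ) : ∫ z in ModularGroup.fd, φ z =
    ∫ z in fdSet, ((z.im : ℂ) ^ 2)⁻¹ * φ (ofComplex z) := by
  rw [volume_def, setIntegral_withDensity_eq_setIntegral_smul measurable_density _
    ModularGroup.isClosed_fd.measurableSet, density_smul, ← preimage_coe_fdSet]
  rw [Function.comp_def, measurePreserving_coe.setIntegral_preimage_emb measurableEmbedding_coe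
      (fun z : ℂ => ((z.im : ℂ) ^ 2)⁻¹ * φ (ofComplex z)),
    Measure.restrict_restrict_of_subset fdSet_subset_range]

theorem peterssonIntegrand_slash (k : ℕ) (f g : ℍ → ℂ) (A : SL(2, ℤ)) (z : ℍ) :
    peterssonIntegrand k (f ∣[(k : ℤ)] A) (g ∣[(k : ℤ)] A) z =
      peterssonIntegrand k f g (A • z) := by
  have := petersson_slash_SL k g f A z
  simp only [petersson, zpow_natCast] at this
  simp only [peterssonIntegrand]
  rw [mul_comm (f _), ← this]
  ring

theorem setIntegral_smul_fd (A : SL(2, ℤ)) (φ : ℍ → ℂ) :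
    ∫ z in A • ModularGroup.fd, φ z = ∫ z in ModularGroup.fd, φ (A • z) :=
  (measurePreserving_smul A volume).setIntegral_image_emb (measurableEmbedding_const_smul A) φ _

theorem integrableOn_smul_fd {A : SL(2, ℤ)} {φ : ℍ → ℂ} :
    IntegrableOn φ (A • ModularGroup.fd) ↔
      IntegrableOn (fun z => φ (A • z)) ModularGroup.fd :=
  (measurePreserving_smul A volume).integrableOn_image (measurableEmbedding_const_smul A)

/-- The Petersson integral over an arbitrary fundamental domain, unfolded to the standard
fundamental domain of `SL₂(ℤ)`. -/
theorem setIntegral_peterssonIntegrand [Γ.FiniteIndex] {k : ℕ} {f g : ℍ → ℂ}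
    (hf : ∀ γ ∈ Γ, f ∣[(k : ℤ)] γ = f) (hg : ∀ γ ∈ Γ, g ∣[(k : ℤ)] γ = g)
    (hint : ∀ A : SL(2, ℤ), IntegrableOn
      (peterssonIntegrand k (f ∣[(k : ℤ)] A) (g ∣[(k : ℤ)] A)) ModularGroup.fd)
    {D : Set ℍ} (hD : IsFundamentalDomain (projGroup Γ) D volume) :
    IntegrableOn (peterssonIntegrand k f g) D ∧
      ∫ z in D, peterssonIntegrand k f g z =
        ∑ q : Quotient (QuotientGroup.rightRel (plusMinus Γ)), ∫ z in ModularGroup.fd,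
          peterssonIntegrand k (f ∣[(k : ℤ)] q.out) (g ∣[(k : ℤ)] q.out) z := by
  have hinv : ∀ (e : projGroup Γ) (z : ℍ),
      peterssonIntegrand k f g (e • z) = peterssonIntegrand k f g z := by
    intro e z
    obtain ⟨γ, hγ, h⟩ := exists_of_mem_projGroup e
    rw [h, ← peterssonIntegrand_slash, hf γ hγ, hg γ hγ]
  have hU : IntegrableOn (peterssonIntegrand k f g)
      (⋃ q : Quotient (QuotientGroup.rightRel (plusMinus Γ)), q.out • ModularGroup.fd) := by
    rw [integrableOn_finite_iUnion]
    intro q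
    rw [integrableOn_smul_fd]
    exact (hint q.out).congr_fun (fun z _ => peterssonIntegrand_slash k f g _ z)
      ModularGroup.isClosed_fd.measurableSet
  have hD' := isFundamentalDomain_iUnion (Γ := Γ)
  refine ⟨(hD'.integrableOn_iff hD hinv).mp hU, ?_⟩
  rw [hD.setIntegral_eq hD' hinv, integral_iUnion_ae
    (fun q => (measurableSet_smul_fd _).nullMeasurableSet) pairwise_aedisjoint_out_smul_fd hU,
    tsum_fintype]
  refine Finset.sum_congr rfl fun q _ => ?_
  rw [setIntegral_smul_fd]
  simp only [peterssonIntegrand_slash]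

end

section

open scoped Manifold

/-! ### Decay of cusp forms -/

theorem slash_apply_mul_inv (k : ℕ) (f : ℍ → ℂ) (A M : SL(2, ℤ)) (z : ℍ) :
    (f ∣[(k : ℤ)] A) z = (f ∣[(k : ℤ)] (A * M⁻¹)) (M • z) *
      (denom (M : GL (Fin 2) ℝ) z ^ k)⁻¹ := by
  have h : f ∣[(k : ℤ)] A = (f ∣[(k : ℤ)] (A * M⁻¹)) ∣[(k : ℤ)] M := by
    rw [← SlashAction.slash_mul, inv_mul_cancel_right]
  rw [h]
  generalize f ∣[(k : ℤ)] (A * M⁻¹) = F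
  rw [ModularForm.SL_slash_apply, zpow_neg, zpow_natCast]

theorem slash_mem {Γ : Subgroup SL(2, ℤ)} {k : ℕ} (f : CuspForm (Γ.map (mapGL ℝ)) (k : ℤ)) {γ : SL(2, ℤ)} (hγ : γ ∈ Γ) :
    (f : ℍ → ℂ) ∣[(k : ℤ)] γ = f :=
  SlashInvariantFormClass.slash_action_eq f _ (Subgroup.mem_map_of_mem _ hγ)

theorem mdiff_slash {Γ : Subgroup SL(2, ℤ)} {k : ℕ} (f : CuspForm (Γ.map (mapGL ℝ)) (k : ℤ))
    (A : SL(2, ℤ)) : MDiff ((f : ℍ → ℂ) ∣[(k : ℤ)] A) :=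
  (CuspFormClass.holo f).slash k (A : GL (Fin 2) ℝ)

/-- The extension of `f|A` by a constant to the complex plane. -/
def slashExt (k : ℕ) (f : ℍ → ℂ) (A : SL(2, ℤ)) (z : ℂ) : ℂ := (f ∣[(k : ℤ)] A) (ofComplex z)

theorem differentiableOn_slashExt {Γ : Subgroup SL(2, ℤ)} {k : ℕ}
    (f : CuspForm (Γ.map (mapGL ℝ)) (k : ℤ)) (A : SL(2, ℤ)) :
    DifferentiableOn ℂ (slashExt k f A) {z | 0 < z.im} :=
  mdifferentiable_iff.mp (mdiff_slash f A)

/-- The coefficient of `Xⁿ` in `f|A (z) (z - X)^(k-2)`. -/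
def periodForm (k : ℕ) (f : ℍ → ℂ) (A : SL(2, ℤ)) (n : ℕ) (z : ℂ) : ℂ :=
  slashExt k f A z * ((C z - X : ℂ[X]) ^ (k - 2)).coeff n

theorem differentiableOn_periodForm {Γ : Subgroup SL(2, ℤ)} {k : ℕ}
    (f : CuspForm (Γ.map (mapGL ℝ)) (k : ℤ)) (A : SL(2, ℤ)) (n : ℕ) :
    DifferentiableOn ℂ (periodForm k f A n) {z | 0 < z.im} := by
  refine (differentiableOn_slashExt f A).mul ?_
  simp only [coeff_C_sub_X_pow]
  fun_prop

variable {Γ : Subgroup SL(2, ℤ)} [Γ.FiniteIndex] {k : ℕ}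

/-- Finite index makes A∞ a cusp of Γ for every A, and f vanishes at all cusps. -/
theorem isZeroAtImInfty_slash (f : CuspForm (Γ.map (mapGL ℝ)) (k : ℤ)) (A : SL(2, ℤ)) :
    IsZeroAtImInfty ((f : ℍ → ℂ) ∣[(k : ℤ)] A) := by
  have hc : IsCusp (mapGL ℝ A • OnePoint.infty) (mapGL ℝ : SL(2, ℤ) →* _).range :=
    isCusp_SL2Z_iff'.mpr ⟨A, rfl⟩
  have h := CuspFormClass.zero_at_cusps f
    ((Subgroup.IsArithmetic.isCusp_iff_isCusp_SL2Z (Γ.map (mapGL ℝ))).mpr hc)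
  exact (OnePoint.isZeroAt_iff_forall_SL2Z hc).mp h A rfl

/-- By finite index some positive power of A T A⁻¹ lies in Γ, and this power is a period of f|A. -/
theorem exists_periodic_slash (f : CuspForm (Γ.map (mapGL ℝ)) (k : ℤ)) (A : SL(2, ℤ)) :
    ∃ n : ℕ, 0 < n ∧
      Function.Periodic (((f : ℍ → ℂ) ∣[(k : ℤ)] A) ∘ ofComplex) ((n : ℝ) : ℂ) := by
  obtain ⟨n, hn, -, hmem⟩ := Γ.exists_pow_mem_of_index_ne_zero Subgroup.FiniteIndex.index_ne_zero
    (A * ModularGroup.T * A⁻¹)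
  rw [conj_pow] at hmem
  have hinv : ((f : ℍ → ℂ) ∣[(k : ℤ)] A) ∣[(k : ℤ)] (ModularGroup.T ^ n) =
      (f : ℍ → ℂ) ∣[(k : ℤ)] A := by
    have h : A * ModularGroup.T ^ n = (A * ModularGroup.T ^ n * A⁻¹) * A := by group
    rw [← SlashAction.slash_mul, h, SlashAction.slash_mul, slash_mem f hmem]
  refine ⟨n, hn, fun z => ?_⟩
  -- Outside the upper half-plane `ofComplex` takes a constant default value, so periodicity is
  -- automatic there.
  rcases le_or_gt z.im 0 with hz | hz
  · rw [Function.comp_apply, Function.comp_apply, ofComplex_apply_of_im_nonpos hz,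
      ofComplex_apply_of_im_nonpos (by simpa using hz)]
  · obtain ⟨z, rfl⟩ : ∃ z' : ℍ, (z' : ℂ) = z := ⟨⟨z, hz⟩, rfl⟩
    have hT : ((ModularGroup.T ^ n • z : ℍ) : ℂ) = z + ((n : ℝ) : ℂ) := by
      have := ModularGroup.coe_T_zpow_smul_eq (z := z) (n := n)
      simpa using this
    rw [← hT, Function.comp_apply, Function.comp_apply, ofComplex_apply, ofComplex_apply]
    have hden : denom ((ModularGroup.T ^ n : SL(2, ℤ)) : GL (Fin 2) ℝ) z = 1 := by
      rw [denom_SL, ← zpow_natCast, ModularGroup.coe_T_zpow]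
      simp
    conv_rhs => rw [slash_apply_mul_inv k f A (ModularGroup.T ^ n), hden]
    have h : (f : ℍ → ℂ) ∣[(k : ℤ)] (A * (ModularGroup.T ^ n)⁻¹) =
        (f : ℍ → ℂ) ∣[(k : ℤ)] A := by
      conv_lhs => rw [SlashAction.slash_mul, ← hinv, ← SlashAction.slash_mul, mul_inv_cancel,
        SlashAction.slash_one]
    rw [h, one_pow, inv_one, mul_one]

theorem exp_decay_slash (f : CuspForm (Γ.map (mapGL ℝ)) (k : ℤ)) (A : SL(2, ℤ)) :
    ∃ c > 0, ((f : ℍ → ℂ) ∣[(k : ℤ)] A) =O[atImInfty] fun τ => Real.exp (-c * τ.im) := by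
  obtain ⟨n, hn, hper⟩ := exists_periodic_slash f A
  have hn' : (0 : ℝ) < n := by exact_mod_cast hn
  have h0 := isZeroAtImInfty_slash f A
  refine ⟨2 * Real.pi / n, by positivity, ?_⟩
  convert h0.exp_decay_atImInfty hn' hper (mdiff_slash f A) h0.isBoundedAtImInfty using 3
  ring

/-- The function |f|² y^k is bounded, and slashing f by A composes it with A; dividing by y^k ≥ δ^k
bounds f|A. -/
theorem exists_bound_slash (f : CuspForm (Γ.map (mapGL ℝ)) (k : ℤ)) (A : SL(2, ℤ)) {δ : ℝ}
    (hδ : 0 < δ) : ∃ C ≥ 0, ∀ z : ℍ, δ ≤ z.im → ‖((f : ℍ → ℂ) ∣[(k : ℤ)] A) z‖ ≤ C := by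
  obtain ⟨C, hC⟩ := CuspFormClass.petersson_bounded_left (k : ℤ) (Γ.map (mapGL ℝ)) f f
  refine ⟨√(C / δ ^ k), Real.sqrt_nonneg _, fun z hz => Real.le_sqrt_of_sq_le ?_⟩
  have h := hC (A • z)
  rw [← petersson_slash_SL, petersson] at h
  simp only [norm_mul, Complex.norm_conj, zpow_natCast, norm_pow, Complex.norm_real,
    Real.norm_eq_abs, abs_of_pos z.im_pos] at h
  rw [le_div_iff₀ (by positivity), sq]
  refine le_trans ?_ h
  gcongr

theorem stripDecay_slashExt (f : CuspForm (Γ.map (mapGL ℝ)) (k : ℤ)) (A : SL(2, ℤ)) :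
    StripDecay (slashExt k f A) := by
  intro δ hδ B
  obtain ⟨c, hc, hO⟩ := exp_decay_slash f A
  obtain ⟨C, hC, hb⟩ := exists_bound_slash f A hδ
  obtain ⟨C', hC', hO'⟩ := hO.exists_pos
  obtain ⟨Y, -, hY⟩ := atImInfty_basis.eventually_iff.mp hO'.bound
  -- `C'` serves above height `Y`; below it the plain bound `C` is absorbed by the factor exp(cY).
  refine ⟨C' + C * Real.exp (c * Y), by positivity, c, hc, fun z hz _ => ?_⟩
  obtain ⟨z, rfl⟩ : ∃ z' : ℍ, (z' : ℂ) = z := ⟨⟨z, hδ.trans_le hz⟩, rfl⟩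
  rw [slashExt, ofComplex_apply, coe_im, add_mul]
  rcases le_or_gt Y z.im with h | h
  · have h1 := hY (x := z) h
    rw [Real.norm_of_nonneg (Real.exp_pos _).le] at h1
    have : 0 ≤ C * Real.exp (c * Y) * Real.exp (-c * z.im) := by positivity
    linarith
  · have h1 := hb z hz
    have h2 : C ≤ C * Real.exp (c * Y) * Real.exp (-c * z.im) := by
      rw [mul_assoc, ← Real.exp_add]
      refine le_mul_of_one_le_right hC (Real.one_le_exp ?_)
      nlinarith
    have : 0 ≤ C' * Real.exp (-c * z.im) := by positivity
    linarith

/-! ### Period integrals -/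

theorem stripDecay_periodForm (f : CuspForm (Γ.map (mapGL ℝ)) (k : ℤ)) (A : SL(2, ℤ))
    (n : ℕ) : StripDecay (periodForm k f A n) := by
  have := ((stripDecay_slashExt f A).pow_mul (k - 2 - n)).const_mul
    ((-1) ^ n * ((k - 2).choose n : ℂ))
  refine this.mono 1 fun z _ => le_of_eq ?_
  rw [one_mul, periodForm, coeff_C_sub_X_pow]
  congr 1
  ring

theorem periodIntegrand_eq (k : ℕ) (f : ℍ → ℂ) (A : SL(2, ℤ)) (n : ℕ) (y : ℝ) :
    periodIntegrand k f A n y = periodForm k f A n (y * Complex.I) * Complex.I := by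
  rw [periodIntegrand, periodForm, slashExt, mul_comm Complex.I]

/-- S exchanges iy and i/y, turning behaviour near 0 into decay at i∞ for the coset of A S⁻¹. -/
theorem norm_slashExt_S (f : ℍ → ℂ) (A : SL(2, ℤ)) {y : ℝ} (hy : 0 < y) :
    ‖slashExt k f A (y * Complex.I)‖ = ‖((1 / y : ℝ) * Complex.I) ^ k *
      slashExt k f (A * ModularGroup.S⁻¹) ((1 / y : ℝ) * Complex.I)‖ := by
  obtain ⟨z, hz⟩ : ∃ z : ℍ, (z : ℂ) = y * Complex.I := ⟨⟨y * Complex.I, by simpa using hy⟩, rfl⟩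
  have hSz : ((ModularGroup.S • z : ℍ) : ℂ) = (1 / y : ℝ) * Complex.I := by
    rw [modular_S_smul, coe_mk, hz]
    have : (y : ℂ) ≠ 0 := by exact_mod_cast hy.ne'
    push_cast
    rw [← neg_inv, mul_inv, Complex.inv_I]
    simp
  rw [slashExt, slashExt, ← hz, ← hSz, ofComplex_apply, ofComplex_apply,
    slash_apply_mul_inv k f A ModularGroup.S, ModularGroup.denom_S, norm_mul, norm_mul, mul_comm,
    hSz, hz]
  simp

theorem integrableOn_periodIntegrand (f : CuspForm (Γ.map (mapGL ℝ)) (k : ℤ)) (A : SL(2, ℤ))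
    (n : ℕ) : IntegrableOn (periodIntegrand k f A n) (Set.Ioi 0) := by
  have hcont : ContinuousOn (periodIntegrand k f A n) (Set.Ioi 0) := by
    simp only [funext (periodIntegrand_eq k f A n)]
    refine ContinuousOn.mul ((differentiableOn_periodForm f A n).continuousOn.comp
      (by fun_prop) fun y hy => ?_) continuousOn_const
    simpa using hy
  rw [← Set.Ioc_union_Ioi_eq_Ioi zero_le_one]
  refine IntegrableOn.union ?_ ?_
  -- On (0, 1] boundedness is enough; it follows from decay at the inverted point, including the
  -- automorphy factor of degree k.
  · obtain ⟨C, hC, c, hc, hb⟩ := (stripDecay_slashExt f (A * ModularGroup.S⁻¹)).pow_mul k 1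
      one_pos 0
    refine IntegrableOn.of_bound (by simp)
      ((hcont.mono Set.Ioc_subset_Ioi_self).aestronglyMeasurable measurableSet_Ioc)
      (C * ((k - 2).choose n : ℝ)) ?_
    filter_upwards [ae_restrict_mem measurableSet_Ioc] with y hy
    rw [periodIntegrand_eq, norm_mul, Complex.norm_I, mul_one, periodForm, norm_mul,
      norm_slashExt_S _ _ hy.1]
    refine mul_le_mul ?_ ?_ (norm_nonneg _) hC
    · have h1 : 1 ≤ 1 / y := by rw [one_le_div hy.1]; exact hy.2
      refine (hb _ (by simpa using h1) (by simp)).trans ?_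
      refine mul_le_of_le_one_right hC (Real.exp_le_one_iff.mpr ?_)
      simp only [Complex.mul_I_im, Complex.ofReal_re]
      nlinarith
    · rw [coeff_C_sub_X_pow]
      simp only [norm_mul, norm_pow, norm_neg, norm_one, one_pow, one_mul, Complex.norm_real,
        Complex.norm_I, mul_one, Complex.norm_natCast, Real.norm_eq_abs, abs_of_pos hy.1]
      exact mul_le_of_le_one_left (Nat.cast_nonneg _) (pow_le_one₀ hy.1.le hy.2)
  · obtain ⟨C, hC, c, hc, hb⟩ := stripDecay_periodForm f A n 1 one_pos 0
    refine Integrable.mono' ((exp_neg_integrableOn_Ioi 1 hc).const_mul C)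
      ((hcont.mono (Set.Ioi_subset_Ioi zero_le_one)).aestronglyMeasurable measurableSet_Ioi) ?_
    filter_upwards [ae_restrict_mem measurableSet_Ioi] with y hy
    have hy : (1 : ℝ) < y := hy
    rw [periodIntegrand_eq, norm_mul, Complex.norm_I, mul_one]
    simpa using hb (y * Complex.I) (by simpa using hy.le) (by simp)

end

section

/-! ### The Eichler integral -/

variable {Γ : Subgroup SL(2, ℤ)} {k : ℕ}

/-- The polynomial `∫_z^{i∞} f|A (t) (t - X)^(k-2) dt`. -/
def eichlerAt (k : ℕ) (f : ℍ → ℂ) (A : SL(2, ℤ)) (z : ℂ) : ℂ[X] :=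
  ∑ n ∈ Finset.range (k - 2 + 1), monomial n (vertInt (periodForm k f A n) z)

theorem neg_one_pow_sub_two (hk : 2 ≤ k) : (-1 : ℂ) ^ k = (-1) ^ (k - 2) := by
  obtain ⟨m, rfl⟩ := Nat.exists_eq_add_of_le hk
  simp [pow_add]

/-- The Eichler integral of `f` as a function with values in the induced module. -/
def eichler (hk : 2 ≤ k) (f : CuspForm (Γ.map (mapGL ℝ)) (k : ℤ)) (z : ℍ) :
    inducedModule Γ (k - 2) :=
  ⟨fun A => eichlerAt k f A z,
    fun A => Submodule.sum_mem _ fun n hn => by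
      rw [mem_degreeLE]
      refine (degree_monomial_le _ _).trans ?_
      exact_mod_cast Nat.lt_succ_iff.mp (Finset.mem_range.mp hn),
    fun γ hγ A => by
      have h : (f : ℍ → ℂ) ∣[(k : ℤ)] γ = f :=
        SlashInvariantFormClass.slash_action_eq f _ (Subgroup.mem_map_of_mem _ hγ)
      simp only [eichlerAt, vertInt, periodForm, slashExt, SlashAction.slash_mul, h],
    fun A => by
      simp only [eichlerAt, vertInt, periodForm, slashExt, slash_neg_SL, neg_one_pow_sub_two hk,
        Finset.smul_sum, Pi.smul_apply, smul_eq_mul, mul_assoc, integral_const_mul,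
        smul_monomial]⟩

/-- The value `f|A (z) (z - X)^(k-2)`, `A ∈ SL₂(ℤ)`, of the differential form attached to `f`. -/
def formValue (hk : 2 ≤ k) (f : CuspForm (Γ.map (mapGL ℝ)) (k : ℤ)) (z : ℍ) :
    inducedModule Γ (k - 2) :=
  ⟨fun A => ((f : ℍ → ℂ) ∣[(k : ℤ)] A) z • (C (z : ℂ) - X) ^ (k - 2),
    fun A => Submodule.smul_mem _ _ (C_sub_X_pow_mem _ _),
    fun γ hγ A => by
      have h : (f : ℍ → ℂ) ∣[(k : ℤ)] γ = f :=
        SlashInvariantFormClass.slash_action_eq f _ (Subgroup.mem_map_of_mem _ hγ)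
      simp only [SlashAction.slash_mul, h],
    fun A => by
      simp only [slash_neg_SL, neg_one_pow_sub_two hk, Pi.smul_apply, smul_eq_mul, mul_smul]⟩

/-- The form contributes j^k and the kernel j^{-(k-2)}. The remaining j² is cancelled by d(Mz) = j⁻²
dz. -/
theorem act_formValue (hk : 2 ≤ k) (f : CuspForm (Γ.map (mapGL ℝ)) (k : ℤ)) (M : SL(2, ℤ))
    (z : ℍ) : act (formValue hk f (M • z)) M =
      denom (M : GL (Fin 2) ℝ) z ^ 2 • formValue hk f z := by
  refine Subtype.ext (funext fun A => ?_)
  change stroke _ (((f : ℍ → ℂ) ∣[(k : ℤ)] (A * M⁻¹)) (M • z) • _) M =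
    denom (M : GL (Fin 2) ℝ) z ^ 2 • (((f : ℍ → ℂ) ∣[(k : ℤ)] A) z • (C (z : ℂ) - X) ^ (k - 2))
  have hd := denom_ne_zero (M : GL (Fin 2) ℝ) z
  rw [stroke_smul, ← stroke_C_sub_X_pow (k - 2) M z, smul_smul, smul_smul,
    slash_apply_mul_inv k f A M]
  congr 1
  have hpow := pow_sub_mul_pow (denom (M : GL (Fin 2) ℝ) z) hk
  rw [← hpow]
  have hd2 := pow_ne_zero (k - 2) hd
  field_simp

/-- Limits and derivatives of polynomial-valued functions are taken through linear functionals L,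
which reduces them to scalar vertical integrals. -/
theorem map_eichlerAt (f : ℍ → ℂ) (A : SL(2, ℤ)) (L : ℂ[X] →ₗ[ℂ] ℂ) (z : ℂ) :
    L (eichlerAt k f A z) =
      ∑ n ∈ Finset.range (k - 2 + 1), L (X ^ n) * vertInt (periodForm k f A n) z := by
  rw [eichlerAt, map_sum]
  refine Finset.sum_congr rfl fun n _ => ?_
  rw [← C_mul_X_pow_eq_monomial, ← smul_eq_C_mul, map_smul, smul_eq_mul, mul_comm]

variable [Γ.FiniteIndex]

theorem stripDecay_map_eichlerAt (f : CuspForm (Γ.map (mapGL ℝ)) (k : ℤ)) (A : SL(2, ℤ))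
    (L : ℂ[X] →ₗ[ℂ] ℂ) : StripDecay fun z => L (eichlerAt k f A z) := by
  simp only [map_eichlerAt]
  exact StripDecay.sum _ fun n _ =>
    (stripDecay_vertInt (stripDecay_periodForm f A n)).const_mul _

theorem hasDerivAt_map_eichlerAt (f : CuspForm (Γ.map (mapGL ℝ)) (k : ℤ)) (A : SL(2, ℤ))
    (L : ℂ[X] →ₗ[ℂ] ℂ) {z : ℂ} (hz : 0 < z.im) :
    HasDerivAt (fun z => L (eichlerAt k f A z))
      (-(slashExt k f A z * L ((C z - X) ^ (k - 2)))) z := by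
  simp only [map_eichlerAt]
  have h := HasDerivAt.fun_sum (u := Finset.range (k - 2 + 1)) fun n _ =>
    (hasDerivAt_vertInt (differentiableOn_periodForm f A n) (stripDecay_periodForm f A n)
      hz).const_mul (L (X ^ n))
  refine h.congr_deriv ?_
  rw [map_eq_sum_coeff (C_sub_X_pow_mem (k - 2) z), Finset.mul_sum, ← Finset.sum_neg_distrib]
  refine Finset.sum_congr rfl fun n _ => ?_
  rw [periodForm]
  ring

theorem tendsto_map_eichlerAt_zero (f : CuspForm (Γ.map (mapGL ℝ)) (k : ℤ)) (A : SL(2, ℤ))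
    (L : ℂ[X] →ₗ[ℂ] ℂ) : Filter.Tendsto
      (fun n : ℕ => L (eichlerAt k f A ((1 / ((n : ℝ) + 1) : ℝ) * Complex.I))) Filter.atTop
      (nhds (L (periodPolyAt k f A))) := by
  have hL : L (periodPolyAt k f A) = ∑ n ∈ Finset.range (k - 2 + 1), L (X ^ n) *
      ∫ y in Set.Ioi (0 : ℝ), periodForm k f A n (y * Complex.I) * Complex.I := by
    rw [periodPolyAt, map_sum]
    refine Finset.sum_congr rfl fun n _ => ?_
    rw [← C_mul_X_pow_eq_monomial, ← smul_eq_C_mul, map_smul, smul_eq_mul, mul_comm]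
    simp only [periodIntegrand_eq]
  rw [hL]
  simp only [map_eichlerAt]
  refine tendsto_finsetSum _ fun n _ => (tendsto_vertInt_zero ?_).const_mul _
  have := integrableOn_periodIntegrand f A n
  rwa [funext (periodIntegrand_eq k f A n)] at this

theorem StripDecay.tendsto {ψ : ℂ → ℂ} (h : StripDecay ψ) (x : ℝ) :
    Filter.Tendsto (fun n : ℕ => ψ (x + ((n : ℝ) + 1 : ℝ) * Complex.I)) Filter.atTop (nhds 0) := by
  obtain ⟨C, hC, c, hc, hb⟩ := h 1 one_pos |x|
  refine squeeze_zero_norm (a := fun n : ℕ => C * Real.exp (-c * ((n : ℝ) + 1))) (fun n => ?_) ?_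
  · simpa using hb (x + ((n : ℝ) + 1 : ℝ) * Complex.I) (by simp) (by simp)
  · have : Filter.Tendsto (fun n : ℕ => -c * ((n : ℝ) + 1)) Filter.atTop Filter.atBot :=
      (Filter.tendsto_atTop_add_const_right _ 1 tendsto_natCast_atTop_atTop).const_mul_atTop_of_neg
        (by linarith)
    simpa using (Real.tendsto_exp_atBot.comp this).const_mul C

theorem hasDerivAt_moebius (M : SL(2, ℤ)) (z : ℍ) :
    HasDerivAt (fun w : ℂ => ((M • ofComplex w : ℍ) : ℂ))
      ((denom (M : GL (Fin 2) ℝ) z ^ 2)⁻¹) z := by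
  have hd := denom_ne_zero (M : GL (Fin 2) ℝ) z
  rw [denom_SL] at hd ⊢
  have h1 : HasDerivAt (fun w : ℂ => (M 0 0 : ℂ) * w + (M 0 1 : ℂ)) (M 0 0 : ℂ) z := by
    simpa using ((hasDerivAt_id (z : ℂ)).const_mul (M 0 0 : ℂ)).add_const (M 0 1 : ℂ)
  have h2 : HasDerivAt (fun w : ℂ => (M 1 0 : ℂ) * w + (M 1 1 : ℂ)) (M 1 0 : ℂ) z := by
    simpa using ((hasDerivAt_id (z : ℂ)).const_mul (M 1 0 : ℂ)).add_const (M 1 1 : ℂ)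
  refine ((h1.div h2 hd).congr_deriv ?_).congr_of_eventuallyEq ?_
  · rw [div_eq_iff (pow_ne_zero 2 hd), inv_mul_cancel₀ (pow_ne_zero 2 hd)]
    linear_combination det_SL M
  · filter_upwards [isOpen_upperHalfPlaneSet.mem_nhds z.im_pos] with w hw
    obtain ⟨w, rfl⟩ : ∃ w' : ℍ, (w' : ℂ) = w := ⟨⟨w, hw⟩, rfl⟩
    have hw' := denom_ne_zero (M : GL (Fin 2) ℝ) w
    rw [denom_SL] at hw'
    rw [ofComplex_apply, Pi.div_apply, eq_div_iff hw', coe_smul_mul_denom]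

/-- The Eichler integral is equivariant up to a constant. -/
theorem act_eichler_sub_eq (hk : 2 ≤ k) (f : CuspForm (Γ.map (mapGL ℝ)) (k : ℤ)) (M : SL(2, ℤ))
    (z z' : ℍ) : act (eichler hk f (M • z)) M - eichler hk f z =
      act (eichler hk f (M • z')) M - eichler hk f z' := by
  refine Subtype.ext (funext fun A => Polynomial.ext fun n => ?_)
  set L : ℂ[X] →ₗ[ℂ] ℂ := (lcoeff ℂ n).comp (strokeHom (k - 2) M) with hL
  set G : ℂ → ℂ := fun w => L (eichlerAt k f (A * M⁻¹) ((M • ofComplex w : ℍ) : ℂ)) -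
    lcoeff ℂ n (eichlerAt k f A w) with hG
  -- The chain rule factor j⁻² of the Möbius map cancels the j² of `act_formValue`.
  have hGd : ∀ w : ℍ, HasDerivAt G 0 w := by
    intro w
    have h1 := (hasDerivAt_map_eichlerAt f (A * M⁻¹) L (z := ((M • ofComplex (w : ℂ) : ℍ) : ℂ))
      (M • ofComplex (w : ℂ)).im_pos).comp (w : ℂ) (hasDerivAt_moebius M w)
    have h2 := hasDerivAt_map_eichlerAt f A (lcoeff ℂ n) w.im_pos
    refine (h1.sub h2).congr_deriv ?_
    have h3 := congrArg (fun P : inducedModule Γ (k - 2) => (P.1 A).coeff n)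
      (act_formValue hk f M w)
    have hd := denom_ne_zero (M : GL (Fin 2) ℝ) w
    change (stroke _ (((f : ℍ → ℂ) ∣[(k : ℤ)] (A * M⁻¹)) (M • w) • _) M).coeff n =
      (denom (M : GL (Fin 2) ℝ) w ^ 2 •
        (((f : ℍ → ℂ) ∣[(k : ℤ)] A) w • (C (w : ℂ) - X) ^ (k - 2))).coeff n at h3
    rw [stroke_smul, coeff_smul, coeff_smul, coeff_smul, smul_eq_mul, smul_eq_mul,
      smul_eq_mul] at h3
    simp only [slashExt, ofComplex_apply, hL, LinearMap.comp_apply, strokeHom_apply, lcoeff_apply]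
    rw [h3]
    field_simp
    ring
  have hconst : G z = G z' :=
    isOpen_upperHalfPlaneSet.is_const_of_deriv_eq_zero
      (Complex.isConnected_of_upperHalfPlane subset_rfl (by grind)).isPreconnected
      (fun w hw => (hGd ⟨w, hw⟩).differentiableAt.differentiableWithinAt)
      (fun w hw => (hGd ⟨w, hw⟩).deriv) z.im_pos z'.im_pos
  simp only [hG, ofComplex_apply] at hconst
  exact hconst

/-- The point `i(n+1)`. -/
def imPoint (n : ℕ) : ℍ := ⟨((n : ℝ) + 1 : ℝ) * Complex.I, by simp; positivity⟩

/-- The defect is constant, so it may be computed along i(m+1); there both terms tend to zero. -/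
theorem act_eichler_T (hk : 2 ≤ k) (f : CuspForm (Γ.map (mapGL ℝ)) (k : ℤ)) (z : ℍ) :
    act (eichler hk f (ModularGroup.T • z)) ModularGroup.T = eichler hk f z := by
  rw [← sub_eq_zero]
  refine Subtype.ext (funext fun A => Polynomial.ext fun n => ?_)
  have h : ∀ m : ℕ, lcoeff ℂ n ((act (eichler hk f (ModularGroup.T • z)) ModularGroup.T -
      eichler hk f z).1 A) = ((lcoeff ℂ n).comp (strokeHom (k - 2) ModularGroup.T))
        (eichlerAt k f (A * ModularGroup.T⁻¹) ((1 : ℝ) + ((m : ℝ) + 1 : ℝ) * Complex.I)) -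
      lcoeff ℂ n (eichlerAt k f A ((0 : ℝ) + ((m : ℝ) + 1 : ℝ) * Complex.I)) := by
    intro m
    rw [act_eichler_sub_eq hk f ModularGroup.T z (imPoint m)]
    have h1 : ((ModularGroup.T • imPoint m : ℍ) : ℂ) =
        (1 : ℝ) + ((m : ℝ) + 1 : ℝ) * Complex.I := by
      have := ModularGroup.coe_T_zpow_smul_eq (z := imPoint m) (n := 1)
      rw [zpow_one] at this
      rw [this, add_comm]
      simp [imPoint]
    have h0 : (imPoint m : ℂ) = (0 : ℝ) + ((m : ℝ) + 1 : ℝ) * Complex.I := by simp [imPoint]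
    rw [← h1, ← h0]
    rfl
  have h1 := (stripDecay_map_eichlerAt f (A * ModularGroup.T⁻¹)
    ((lcoeff ℂ n).comp (strokeHom (k - 2) ModularGroup.T))).tendsto 1
  have h2 := (stripDecay_map_eichlerAt f A (lcoeff ℂ n)).tendsto 0
  have h3 := (h1.sub h2).congr fun m => (h m).symm
  rw [sub_zero] at h3
  simpa using tendsto_nhds_unique tendsto_const_nhds h3

/-- The constant defect is again computed along i(m+1). Now S sends these points to i/(m+1), where
the Eichler integral tends to the full period. -/
theorem act_eichler_S_add (hk : 2 ≤ k) (f : CuspForm (Γ.map (mapGL ℝ)) (k : ℤ)) (z : ℍ) :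
    act (eichler hk f (ModularGroup.S • z)) ModularGroup.S =
      eichler hk f z + act (periodPoly hk f) ModularGroup.S := by
  rw [← sub_eq_iff_eq_add']
  refine Subtype.ext (funext fun A => Polynomial.ext fun n => ?_)
  have h : ∀ m : ℕ, lcoeff ℂ n ((act (eichler hk f (ModularGroup.S • z)) ModularGroup.S -
      eichler hk f z).1 A) = ((lcoeff ℂ n).comp (strokeHom (k - 2) ModularGroup.S))
        (eichlerAt k f (A * ModularGroup.S⁻¹) ((1 / ((m : ℝ) + 1) : ℝ) * Complex.I)) -
      lcoeff ℂ n (eichlerAt k f A ((0 : ℝ) + ((m : ℝ) + 1 : ℝ) * Complex.I)) := by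
    intro m
    rw [act_eichler_sub_eq hk f ModularGroup.S z (imPoint m)]
    have h1 : ((ModularGroup.S • imPoint m : ℍ) : ℂ) = (1 / ((m : ℝ) + 1) : ℝ) * Complex.I := by
      rw [modular_S_smul, coe_mk]
      have : ((m : ℂ) + 1) ≠ 0 := by exact_mod_cast m.succ_ne_zero
      simp only [imPoint]
      push_cast
      rw [← neg_inv, mul_inv, Complex.inv_I]
      simp
    have h0 : (imPoint m : ℂ) = (0 : ℝ) + ((m : ℝ) + 1 : ℝ) * Complex.I := by simp [imPoint]
    rw [← h1, ← h0]
    rfl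
  have h1 := tendsto_map_eichlerAt_zero f (A * ModularGroup.S⁻¹)
    ((lcoeff ℂ n).comp (strokeHom (k - 2) ModularGroup.S))
  have h2 := (stripDecay_map_eichlerAt f A (lcoeff ℂ n)).tendsto 0
  have h3 := (h1.sub h2).congr fun m => (h m).symm
  rw [sub_zero] at h3
  exact tendsto_nhds_unique tendsto_const_nhds h3

/-- Applying the transformation law twice returns to the start because S² = -1 acts trivially; the
accumulated defect ρ|S + ρ must vanish. -/
theorem act_periodPoly_S (hk : 2 ≤ k) (f : CuspForm (Γ.map (mapGL ℝ)) (k : ℤ)) :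
    act (periodPoly hk f) ModularGroup.S = -periodPoly hk f := by
  have hS2 : ModularGroup.S * ModularGroup.S = -1 := by decide
  have hSS : ∀ z : ℍ, ModularGroup.S • ModularGroup.S • z = z := fun z => by
    rw [← mul_smul, hS2, ModularGroup.SL_neg_smul, one_smul]
  have h1 := act_eichler_S_add hk f UpperHalfPlane.I
  have h2 := act_eichler_S_add hk f (ModularGroup.S • UpperHalfPlane.I)
  rw [hSS] at h2
  have h3 := congrArg (fun P => act P ModularGroup.S) h2
  simp only [act_add, act_act, hS2, act_neg_one] at h3
  rw [h1] at h3
  rw [eq_neg_iff_add_eq_zero]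
  rw [add_assoc] at h3
  exact left_eq_add.mp h3

theorem act_eichler_S (hk : 2 ≤ k) (f : CuspForm (Γ.map (mapGL ℝ)) (k : ℤ)) (z : ℍ) :
    act (eichler hk f (ModularGroup.S • z)) ModularGroup.S =
      eichler hk f z - periodPoly hk f := by
  rw [act_eichler_S_add, act_periodPoly_S, sub_eq_add_neg]

end

section

variable {Γ : Subgroup SL(2, ℤ)} {k : ℕ}

/-! ### The unit arc -/

/-- The point of the unit circle above `x`, as a point of the upper half-plane. -/
def arcPoint (x : ℝ) : ℍ := ofComplex (arc x)

theorem arc_im_pos {x : ℝ} (hx : |x| < 1) : 0 < (arc x).im := by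
  rw [arc_im]
  exact arcHeight_pos hx

theorem coe_ofComplex {z : ℂ} (hz : 0 < z.im) : (ofComplex z : ℂ) = z := by
  rw [ofComplex_apply_of_im_pos hz]

theorem coe_arcPoint {x : ℝ} (hx : |x| < 1) : (arcPoint x : ℂ) = arc x :=
  coe_ofComplex (arc_im_pos hx)

theorem arc_mul_arc_neg {x : ℝ} (hx : |x| < 1) : arc x * arc (-x) = -1 := by
  have h : (arcHeight x : ℂ) ^ 2 = 1 - (x : ℂ) ^ 2 := by exact_mod_cast arcHeight_sq hx
  rw [arc, arc, arcHeight_neg]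
  push_cast
  linear_combination (arcHeight x : ℂ) ^ 2 * Complex.I_sq - h

theorem S_smul_arcPoint {x : ℝ} (hx : |x| < 1) :
    ModularGroup.S • arcPoint x = arcPoint (-x) := by
  have h0 : arc x ≠ 0 := fun h => by
    have := arc_im_pos hx
    rw [h] at this
    simp at this
  apply UpperHalfPlane.ext
  rw [modular_S_smul, coe_mk, coe_arcPoint hx, coe_arcPoint (by rwa [abs_neg])]
  rw [inv_neg, ← one_div, ← neg_div, div_eq_iff h0, mul_comm, arc_mul_arc_neg hx]

theorem coe_T_smul (z : ℍ) : ((ModularGroup.T • z : ℍ) : ℂ) = z + 1 := by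
  simpa using ModularGroup.coe_T_zpow_smul_eq (z := z) (n := 1)

theorem T_smul_arcPoint : ModularGroup.T • arcPoint (-(1 / 2)) = arcPoint (1 / 2) := by
  have h : |(1 / 2 : ℝ)| < 1 := by rw [abs_of_pos] <;> norm_num
  apply UpperHalfPlane.ext
  rw [coe_T_smul, coe_arcPoint (by rwa [abs_neg]), coe_arcPoint h, arc, arc, arcHeight_neg]
  push_cast
  ring

theorem T_smul_ofComplex {z : ℂ} (hz : 0 < z.im) :
    ofComplex (z + 1) = ModularGroup.T • ofComplex z := by
  apply UpperHalfPlane.ext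
  rw [coe_T_smul, coe_ofComplex hz, coe_ofComplex (by simpa using hz)]

/-- This is the derivative of arc(-x) = -1/arc(x). -/
theorem arcDeriv_neg {x : ℝ} (hx : |x| < 1) : arc x ^ 2 * arcDeriv (-x) = -arcDeriv x := by
  have h : (arcHeight x : ℂ) ^ 2 = 1 - (x : ℂ) ^ 2 := by exact_mod_cast arcHeight_sq hx
  have h0 : (arcHeight x : ℂ) ≠ 0 := by exact_mod_cast (arcHeight_pos hx).ne'
  rw [arc, arcDeriv, arcDeriv, arcHeight_neg]
  push_cast
  field_simp
  ring_nf
  simp only [Complex.I_sq, Complex.I_pow_three]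
  linear_combination ((x : ℂ) * Complex.I - (arcHeight x : ℂ)) * h

/-! ### Stokes' theorem for the Eichler integral -/

/-- The function `W` such that `W(z) dz` is the form `⟪f(z) (z - X)^(k-2), E(z)⟫ dz`. -/
def pairedForm (hk : 2 ≤ k) (f : CuspForm (Γ.map (mapGL ℝ)) (k : ℤ))
    (E : ℍ → inducedModule Γ (k - 2)) (z : ℂ) : ℂ :=
  doublePairing (formValue hk f (ofComplex z)) (E (ofComplex z))

theorem pairedForm_T (hk : 2 ≤ k) (f : CuspForm (Γ.map (mapGL ℝ)) (k : ℤ))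
    {E : ℍ → inducedModule Γ (k - 2)}
    (hT : ∀ z, act (E (ModularGroup.T • z)) ModularGroup.T = E z) {z : ℂ} (hz : 0 < z.im) :
    pairedForm hk f E (z + 1) = pairedForm hk f E z := by
  rw [pairedForm, T_smul_ofComplex hz, ← doublePairing_act _ _ ModularGroup.T, hT, act_formValue,
    denom_SL, pairedForm]
  simp [ModularGroup.T]

variable [Γ.FiniteIndex]

theorem hasDerivAt_doublePairing_eichler (hk : 2 ≤ k) (f : CuspForm (Γ.map (mapGL ℝ)) (k : ℤ))
    (s : inducedModule Γ (k - 2)) {z : ℂ} (hz : 0 < z.im) :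
    HasDerivAt (fun z => doublePairing (eichler hk f (ofComplex z)) s)
      (-doublePairing (formValue hk f (ofComplex z)) s) z := by
  have h := (HasDerivAt.fun_sum (u := Finset.univ)
    fun (q : Quotient (QuotientGroup.rightRel (plusMinus Γ))) _ => hasDerivAt_map_eichlerAt f q.out
      ((pairingForm (k - 2)).flip (s.1 q.out)) hz).const_mul (projIndex Γ : ℂ)⁻¹
  refine (h.congr_deriv ?_).congr_of_eventuallyEq ?_
  · rw [doublePairing_eq_sum, ← mul_neg, ← Finset.sum_neg_distrib]
    congr 1
    refine Finset.sum_congr rfl fun q _ => ?_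
    rw [LinearMap.flip_apply, ← pairingForm_apply, formValue, map_smul, LinearMap.smul_apply,
      coe_ofComplex hz, smul_eq_mul, slashExt]
  · filter_upwards [isOpen_upperHalfPlaneSet.mem_nhds hz] with w hw
    rw [doublePairing_eq_sum]
    simp only [LinearMap.flip_apply, pairingForm_apply, eichler]
    rw [coe_ofComplex hw]

/-- Pulling the form back by S, which reflects the arc, preserves it up to the defect s of E; the
weight 2 factor arc(x)² is absorbed by `arcDeriv_neg`. -/
theorem pairedForm_S (hk : 2 ≤ k) (f : CuspForm (Γ.map (mapGL ℝ)) (k : ℤ))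
    {E : ℍ → inducedModule Γ (k - 2)} {s : inducedModule Γ (k - 2)}
    (hS : ∀ z, act (E (ModularGroup.S • z)) ModularGroup.S = E z - s) {x : ℝ} (hx : |x| < 1) :
    pairedForm hk f E (arc (-x)) * arcDeriv (-x) = -(pairedForm hk f E (arc x) * arcDeriv x) +
      doublePairing (formValue hk f (arcPoint x)) s * arcDeriv x := by
  have h1 : pairedForm hk f E (arc (-x)) = arc x ^ 2 * (pairedForm hk f E (arc x) -
      doublePairing (formValue hk f (arcPoint x)) s) := by
    change doublePairing (formValue hk f (arcPoint (-x))) (E (arcPoint (-x))) = arc x ^ 2 *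
      (doublePairing (formValue hk f (arcPoint x)) (E (arcPoint x)) - _)
    rw [← S_smul_arcPoint hx, ← doublePairing_act _ _ ModularGroup.S, hS, act_formValue,
      ModularGroup.denom_S, coe_arcPoint hx, ← doublePairingForm_apply, map_smul,
      LinearMap.smul_apply, map_sub, smul_eq_mul]
    rfl
  rw [h1]
  linear_combination (pairedForm hk f E (arc x) -
    doublePairing (formValue hk f (arcPoint x)) s) * arcDeriv_neg hx

/-- Adding the arc integral to its reflection leaves only the defect ⟪F_f, s⟫ dz, whose primitive is
-⟪E_f, s⟫. The endpoints of the arc are exchanged by T, so both values involve the same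
E_f(e^{iπ/3}). -/
theorem two_mul_integral_arc (hk : 2 ≤ k) (f : CuspForm (Γ.map (mapGL ℝ)) (k : ℤ))
    {E : ℍ → inducedModule Γ (k - 2)} {s : inducedModule Γ (k - 2)}
    (hS : ∀ z, act (E (ModularGroup.S • z)) ModularGroup.S = E z - s)
    (hc : ContinuousOn (pairedForm hk f E) {z | 0 < z.im}) :
    2 * ∫ x in (-(1 / 2) : ℝ)..(1 / 2), pairedForm hk f E (arc x) * arcDeriv x =
      doublePairing (act (eichler hk f (arcPoint (1 / 2))) ModularGroup.T -
        eichler hk f (arcPoint (1 / 2))) s := by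
  have hle : (-(1 / 2) : ℝ) ≤ 1 / 2 := by norm_num
  set ψ : ℝ → ℂ := fun x => pairedForm hk f E (arc x) * arcDeriv x with hψ
  set χ : ℝ → ℂ := fun x => doublePairing (formValue hk f (arcPoint x)) s * arcDeriv x with hχ
  have hlt : ∀ x ∈ Set.uIcc (-(1 / 2) : ℝ) (1 / 2), |x| < 1 := fun x hx => by
    rw [Set.uIcc_of_le hle] at hx
    exact abs_lt_one_of_abs_le_half (abs_le.mpr hx)
  have harc : ContinuousOn arc (Set.uIcc (-(1 / 2)) (1 / 2)) := fun x hx =>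
    (hasDerivAt_arc (hlt x hx)).continuousAt.continuousWithinAt
  have hψc : ContinuousOn ψ (Set.uIcc (-(1 / 2)) (1 / 2)) := by
    refine (hc.comp harc fun x hx => arc_im_pos (hlt x hx)).mul ?_
    rw [Set.uIcc_of_le hle]
    exact continuousOn_arcDeriv
  have hψi : IntervalIntegrable ψ volume (-(1 / 2)) (1 / 2) := hψc.intervalIntegrable
  have hψi' : IntervalIntegrable (fun x => ψ (-x)) volume (-(1 / 2)) (1 / 2) := by
    refine (hψc.comp continuous_neg.continuousOn fun x hx => ?_).intervalIntegrable
    rw [Set.uIcc_of_le hle] at hx ⊢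
    exact ⟨by linarith [hx.2], by linarith [hx.1]⟩
  have hrel : ∀ x ∈ Set.uIcc (-(1 / 2) : ℝ) (1 / 2), χ x = ψ (-x) + ψ x := fun x hx => by
    simp only [hψ, hχ]
    rw [pairedForm_S hk f hS (hlt x hx)]
    ring
  have hsum : ∫ x in (-(1 / 2) : ℝ)..(1 / 2), χ x =
      2 * ∫ x in (-(1 / 2) : ℝ)..(1 / 2), ψ x := by
    rw [intervalIntegral.integral_congr hrel, intervalIntegral.integral_add hψi' hψi,
      intervalIntegral.integral_comp_neg, neg_neg, two_mul]
  have hderiv : ∀ x ∈ Set.uIcc (-(1 / 2) : ℝ) (1 / 2),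
      HasDerivAt (fun x => doublePairing (eichler hk f (arcPoint x)) s) (-χ x) x := by
    intro x hx
    have h1 := (hasDerivAt_doublePairing_eichler hk f s (arc_im_pos (hlt x hx))).comp x
      (hasDerivAt_arc (hlt x hx))
    refine h1.congr_deriv ?_
    rw [neg_mul]
    rfl
  have hint := intervalIntegral.integral_eq_sub_of_hasDerivAt hderiv
    (IntervalIntegrable.neg <| (hψi'.add hψi).congr_uIoo
      fun x hx => (hrel x (Set.uIoo_subset_uIcc_self hx)).symm)
  rw [intervalIntegral.integral_neg, hsum] at hint
  have hρ : act (eichler hk f (arcPoint (1 / 2))) ModularGroup.T =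
      eichler hk f (arcPoint (-(1 / 2))) := by
    rw [← T_smul_arcPoint, act_eichler_T]
  rw [hρ, ← doublePairingForm_apply, map_sub, LinearMap.sub_apply, doublePairingForm_apply,
    doublePairingForm_apply]
  linear_combination -hint

/-- The reproducing property turns each pairing into evaluation at z. The explicit sum is what
Wirtinger derivatives and decay estimates are applied to. -/
theorem pairedForm_eq (hk : 2 ≤ k) (f : CuspForm (Γ.map (mapGL ℝ)) (k : ℤ))
    {E : ℍ → inducedModule Γ (k - 2)}
    {v : Quotient (QuotientGroup.rightRel (plusMinus Γ)) → ℕ → ℂ → ℂ}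
    (hv : ∀ (z : ℍ) q n, n ≤ k - 2 → ((E z).1 q.out).coeff n = v q n z) {z : ℂ} (hz : 0 < z.im) :
    pairedForm hk f E z = (projIndex Γ : ℂ)⁻¹ * ∑ q, slashExt k f q.out z *
      ((-1) ^ (k - 2) * ∑ n ∈ Finset.range (k - 2 + 1), z ^ n * v q n z) := by
  rw [pairedForm, doublePairing_eq_sum]
  congr 1
  refine Finset.sum_congr rfl fun q _ => ?_
  rw [formValue, ← pairingForm_apply, map_smul, LinearMap.smul_apply, pairingForm_apply,
    pairing_C_sub_X_pow_left ((E _).2.1 _), smul_eq_mul, slashExt,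
    eval_eq_sum_range' (Nat.lt_succ_of_le (natDegree_le_of_mem ((E _).2.1 _)))]
  congr 2
  refine Finset.sum_congr rfl fun n hn => ?_
  rw [hv _ _ _ (Nat.lt_succ_iff.mp (Finset.mem_range.mp hn)), coe_ofComplex hz, mul_comm]

/-- Stokes' theorem and the symmetry of the unit arc: the surface integral of `∂W/∂z̄`, where
`W(z) dz = ⟪f(z) (z - X)^(k-2), E(z)⟫ dz`, as a period pairing. -/
theorem two_mul_integral_fdSet (hk : 2 ≤ k) (f : CuspForm (Γ.map (mapGL ℝ)) (k : ℤ))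
    {E : ℍ → inducedModule Γ (k - 2)} {s : inducedModule Γ (k - 2)}
    (hT : ∀ z, act (E (ModularGroup.T • z)) ModularGroup.T = E z)
    (hS : ∀ z, act (E (ModularGroup.S • z)) ModularGroup.S = E z - s)
    {v va vb : Quotient (QuotientGroup.rightRel (plusMinus Γ)) → ℕ → ℂ → ℂ}
    (hv : ∀ (z : ℍ) q n, n ≤ k - 2 → ((E z).1 q.out).coeff n = v q n z)
    (hvw : ∀ q n z, 0 < z.im → HasWirtingerAt (v q n) (va q n z) (vb q n z) z)
    (hvb : ∀ q n, ContinuousOn (vb q n) {z | 0 < z.im})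
    (dv : ∀ q n, StripDecay (v q n)) (dvb : ∀ q n, StripDecay (vb q n)) :
    2 * ∫ z in fdSet, 2 * Complex.I * ((projIndex Γ : ℂ)⁻¹ * ∑ q, slashExt k f q.out z *
      ((-1) ^ (k - 2) * ∑ n ∈ Finset.range (k - 2 + 1), z ^ n * vb q n z)) =
      doublePairing (act (eichler hk f (arcPoint (1 / 2))) ModularGroup.T -
        eichler hk f (arcPoint (1 / 2))) s := by
  have hopen := isOpen_upperHalfPlaneSet
  have key : ∀ z : ℂ, 0 < z.im → ∃ a : ℂ, HasWirtingerAt (pairedForm hk f E) a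
      ((projIndex Γ : ℂ)⁻¹ * ∑ q, slashExt k f q.out z *
        ((-1) ^ (k - 2) * ∑ n ∈ Finset.range (k - 2 + 1), z ^ n * vb q n z)) z := by
    intro z hz
    have h := (HasWirtingerAt.sum (z := z) Finset.univ
      fun (q : Quotient (QuotientGroup.rightRel (plusMinus Γ))) _ =>
        (((differentiableOn_slashExt f q.out).differentiableAt
          (hopen.mem_nhds hz)).hasDerivAt.hasWirtingerAt.mul
        ((HasWirtingerAt.sum (z := z) (Finset.range (k - 2 + 1)) fun n _ =>
          (hasDerivAt_pow n z).hasWirtingerAt.mul (hvw q n z hz)).const_mul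
            ((-1) ^ (k - 2))))).const_mul (projIndex Γ : ℂ)⁻¹
    simp only [zero_mul, add_zero] at h
    refine ⟨_, HasFDerivAt.congr_of_eventuallyEq h ?_⟩
    filter_upwards [hopen.mem_nhds hz] with w hw
    exact pairedForm_eq hk f hv hw
  choose! a ha using key
  rw [stokes_fdSet (W := pairedForm hk f E) (a := a) ha ?_ (fun z hz => pairedForm_T hk f hT hz)
    ?_ ?_]
  · exact two_mul_integral_arc hk f hS fun z hz => (ha z hz).continuousAt.continuousWithinAt
  · refine continuousOn_const.mul (continuousOn_finsetSum _ fun q _ =>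
      (differentiableOn_slashExt f q.out).continuousOn.mul (continuousOn_const.mul
        (continuousOn_finsetSum _ fun n _ => ?_)))
    exact (continuous_pow n).continuousOn.mul (hvb q n)
  · have h : StripDecay fun z => (projIndex Γ : ℂ)⁻¹ * ∑ q, slashExt k f q.out z *
      ((-1) ^ (k - 2) * ∑ n ∈ Finset.range (k - 2 + 1), z ^ n * v q n z) :=
      (StripDecay.sum _ fun q _ => (stripDecay_slashExt f q.out).mul
        ((StripDecay.sum _ fun n _ => (dv q n).pow_mul n).const_mul _)).const_mul _
    exact h.mono 1 fun z hz => by rw [one_mul, pairedForm_eq hk f hv hz]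
  · exact (StripDecay.sum _ fun q _ => (stripDecay_slashExt f q.out).mul
      ((StripDecay.sum _ fun n _ => (dvb q n).pow_mul n).const_mul _)).const_mul _

/-! ### Haberland's formula -/

/-- The point e^{iπ/3} is fixed by TS, so the transformation laws under T and S at this point
exhibit ρ_f as a coboundary. -/
theorem periodPoly_eq (hk : 2 ≤ k) (f : CuspForm (Γ.map (mapGL ℝ)) (k : ℤ)) :
    periodPoly hk f = eichler hk f (arcPoint (1 / 2)) -
      act (eichler hk f (arcPoint (1 / 2))) (ModularGroup.T * ModularGroup.S) := by
  have h : |(1 / 2 : ℝ)| < 1 := by rw [abs_of_pos] <;> norm_num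
  have h1 : act (eichler hk f (arcPoint (1 / 2))) ModularGroup.T =
      eichler hk f (ModularGroup.S • arcPoint (1 / 2)) := by
    rw [S_smul_arcPoint h, ← T_smul_arcPoint, act_eichler_T]
  rw [← act_act, h1, act_eichler_S, sub_sub_cancel]

theorem coeff_eichlerAt (f : ℍ → ℂ) (A : SL(2, ℤ)) {n : ℕ} (hn : n ≤ k - 2) (z : ℂ) :
    (eichlerAt k f A z).coeff n = vertInt (periodForm k f A n) z := by
  rw [eichlerAt, finsetSum_coeff,
    Finset.sum_eq_single_of_mem n (Finset.mem_range.mpr (Nat.lt_succ_of_le hn))]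
  · simp
  · intro m _ hm
    rw [coeff_monomial, if_neg hm]

/-- The period pairing of two cusp forms vanishes. -/
theorem bracket_periodPoly (hk : 2 ≤ k) (f g : CuspForm (Γ.map (mapGL ℝ)) (k : ℤ)) :
    bracket (periodPoly hk f) (periodPoly hk g) = 0 := by
  -- The Eichler integral is holomorphic, so the ∂/∂z̄ data are zero and the surface integral
  -- disappears.
  have h := two_mul_integral_fdSet hk f (E := eichler hk g) (s := periodPoly hk g)
    (v := fun q n => vertInt (periodForm k g q.out n))
    (va := fun q n z => -periodForm k g q.out n z) (vb := fun _ _ _ => 0)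
    (act_eichler_T hk g) (act_eichler_S hk g) (fun z q n hn => coeff_eichlerAt g q.out hn z)
    (fun q n z hz => (hasDerivAt_vertInt (differentiableOn_periodForm g q.out n)
      (stripDecay_periodForm g q.out n) hz).hasWirtingerAt)
    (fun _ _ => continuousOn_const)
    (fun q n => stripDecay_vertInt (stripDecay_periodForm g q.out n)) (fun _ _ => StripDecay.zero)
  rw [bracket_eq_of_coboundary (periodPoly_eq hk f) (periodPoly_eq hk g) (act_periodPoly_S hk f)
    (act_periodPoly_S hk g), ← h]
  simp

/-- Conjugating coefficients turns the kernel (z - X)^w into (conj z - X)^w, and evaluation at z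
then gives a power of conj z - z, that is, of y. -/
theorem sum_conj_periodForm (g : ℍ → ℂ) (A : SL(2, ℤ)) (z : ℂ) :
    ∑ n ∈ Finset.range (k - 2 + 1), z ^ n * conj (-periodForm k g A n z) =
      -conj (slashExt k g A z) * (conj z - z) ^ (k - 2) := by
  have h : (conj z - z) ^ (k - 2) = ((C (conj z) - X : ℂ[X]) ^ (k - 2)).eval z := by simp
  rw [h, eval_eq_sum_range' (Nat.lt_succ_of_le (natDegree_le_of_mem (C_sub_X_pow_mem _ _))),
    Finset.mul_sum]
  refine Finset.sum_congr rfl fun n _ => ?_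
  simp only [periodForm, coeff_C_sub_X_pow, map_neg, map_mul, map_pow, map_one, map_natCast]
  ring

theorem inv_im_sq_mul_peterssonIntegrand (hk : 2 ≤ k) (f g : ℍ → ℂ) (A : SL(2, ℤ)) {z : ℂ}
    (hz : 0 < z.im) : ((z.im : ℂ) ^ 2)⁻¹ *
      peterssonIntegrand k (f ∣[(k : ℤ)] A) (g ∣[(k : ℤ)] A) (ofComplex z) =
      slashExt k f A z * conj (slashExt k g A z) * (z.im : ℂ) ^ (k - 2) := by
  have h0 : (z.im : ℂ) ≠ 0 := by exact_mod_cast hz.ne'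
  have him : (ofComplex z).im = z.im := by rw [← coe_im, coe_ofComplex hz]
  rw [peterssonIntegrand, him, slashExt, slashExt, ← pow_sub_mul_pow (z.im : ℂ) hk]
  field_simp

theorem integrableOn_fdSet_slashExt (f g : CuspForm (Γ.map (mapGL ℝ)) (k : ℤ)) (A : SL(2, ℤ)) :
    IntegrableOn (fun z => slashExt k f A z * conj (slashExt k g A z) * (z.im : ℂ) ^ (k - 2))
      fdSet := by
  refine integrableOn_fdSet ?_ ?_
  · exact ((differentiableOn_slashExt f A).continuousOn.mul
      (Complex.continuous_conj.comp_continuousOn (differentiableOn_slashExt g A).continuousOn)).mul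
      (by fun_prop)
  · refine (((stripDecay_slashExt f A).mul (stripDecay_slashExt g A).conj).pow_mul
      (k - 2)).mono 1 fun z _ => ?_
    rw [one_mul, norm_mul, norm_mul (z ^ (k - 2)), mul_comm, norm_pow, norm_pow,
      Complex.norm_real, Real.norm_eq_abs]
    gcongr
    exact Complex.abs_im_le_norm z

theorem measurableSet_fdSet : MeasurableSet fdSet := by
  rw [← coe_image_fd]
  exact measurableEmbedding_coe.measurableSet_image.mpr ModularGroup.isClosed_fd.measurableSet

theorem integrableOn_fd_peterssonIntegrand (hk : 2 ≤ k)
    (f g : CuspForm (Γ.map (mapGL ℝ)) (k : ℤ)) (A : SL(2, ℤ)) :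
    IntegrableOn (peterssonIntegrand k ((f : ℍ → ℂ) ∣[(k : ℤ)] A) ((g : ℍ → ℂ) ∣[(k : ℤ)] A))
      ModularGroup.fd :=
  integrableOn_fd ((integrableOn_fdSet_slashExt f g A).congr_fun
    (fun _ hz => (inv_im_sq_mul_peterssonIntegrand hk f g A hz.1).symm) measurableSet_fdSet)

/-- The Petersson product of two cusp forms in terms of their period polynomials. -/
theorem petersson_eq_bracket (hk : 2 ≤ k) (f g : CuspForm (Γ.map (mapGL ℝ)) (k : ℤ)) {D : Set ℍ}
    (hD : IsFundamentalDomain (projGroup Γ) D volume) :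
    IntegrableOn (peterssonIntegrand k f g) D ∧
      6 * haberlandConst k * peterssonProduct Γ D k f g =
        bracket (periodPoly hk f) (conjCoeff (periodPoly hk g)) := by
  obtain ⟨hi, hI⟩ := setIntegral_peterssonIntegrand (f := f) (g := g)
    (fun γ hγ => slash_mem f hγ) (fun γ hγ => slash_mem g hγ)
    (integrableOn_fd_peterssonIntegrand hk f g) hD
  refine ⟨hi, ?_⟩
  have hSc : act (conjCoeff (periodPoly hk g)) ModularGroup.S = -conjCoeff (periodPoly hk g) := by
    rw [← conjCoeff_act, act_periodPoly_S, ← zero_sub, conjCoeff_sub, ← zero_sub]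
    congr 1
    exact Subtype.ext (funext fun _ => Polynomial.map_zero _)
  -- Now E is antiholomorphic: the ∂/∂z part is zero and the ∂/∂z̄ part is the conjugate of -F_g.
  have h := two_mul_integral_fdSet hk f (E := fun z => conjCoeff (eichler hk g z))
    (s := conjCoeff (periodPoly hk g))
    (v := fun q n z => conj (vertInt (periodForm k g q.out n) z))
    (va := fun _ _ _ => 0) (vb := fun q n z => conj (-periodForm k g q.out n z))
    (fun z => by rw [← conjCoeff_act, act_eichler_T])
    (fun z => by rw [← conjCoeff_act, act_eichler_S, conjCoeff_sub])
    (fun z q n hn => by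
      change ((eichlerAt k g q.out z).map _).coeff n = _
      rw [coeff_map, coeff_eichlerAt g q.out hn z])
    (fun q n z hz => (hasDerivAt_vertInt (differentiableOn_periodForm g q.out n)
      (stripDecay_periodForm g q.out n) hz).hasWirtingerAt_conj)
    (fun q n => Complex.continuous_conj.comp_continuousOn
      (differentiableOn_periodForm g q.out n).continuousOn.neg)
    (fun q n => (stripDecay_vertInt (stripDecay_periodForm g q.out n)).conj)
    (fun q n => (stripDecay_periodForm g q.out n).mono 1 fun z _ => by simp)
  rw [bracket_eq_of_coboundary (periodPoly_eq hk f) (v := conjCoeff (eichler hk g _))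
    (by rw [periodPoly_eq hk g, conjCoeff_sub, conjCoeff_act]) (act_periodPoly_S hk f) hSc, ← h,
    peterssonProduct, hI]
  have hfd : ∀ q : Quotient (QuotientGroup.rightRel (plusMinus Γ)), ∫ z in ModularGroup.fd,
      peterssonIntegrand k ((f : ℍ → ℂ) ∣[(k : ℤ)] q.out) ((g : ℍ → ℂ) ∣[(k : ℤ)] q.out) z =
      ∫ z in fdSet, slashExt k f q.out z * conj (slashExt k g q.out z) *
        (z.im : ℂ) ^ (k - 2) := by
    intro q
    rw [setIntegral_fd]
    exact setIntegral_congr_fun measurableSet_fdSet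
      fun z hz => inv_im_sq_mul_peterssonIntegrand hk f g q.out hz.1
  -- Here C_k appears: 2i comes from Stokes, (2i)^{k-2} from (z - conj z)^{k-2}, and the sign from
  -- dE = -F dz.
  have hpt : ∀ z : ℂ, 2 * Complex.I * ((projIndex Γ : ℂ)⁻¹ *
      ∑ q : Quotient (QuotientGroup.rightRel (plusMinus Γ)), slashExt k f q.out z *
        ((-1) ^ (k - 2) * ∑ n ∈ Finset.range (k - 2 + 1),
          z ^ n * conj (-periodForm k g q.out n z))) =
      haberlandConst k * (projIndex Γ : ℂ)⁻¹ *
        ∑ q : Quotient (QuotientGroup.rightRel (plusMinus Γ)),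
          slashExt k f q.out z * conj (slashExt k g q.out z) * (z.im : ℂ) ^ (k - 2) := by
    intro z
    have h1 : (-1) ^ (k - 2) * (conj z - z) ^ (k - 2) =
        (2 * Complex.I) ^ (k - 2) * (z.im : ℂ) ^ (k - 2) := by
      rw [← mul_pow, ← mul_pow]
      congr 1
      have := Complex.sub_conj z
      push_cast at this
      linear_combination this
    have h2 : haberlandConst k = -(2 * Complex.I) * (2 * Complex.I) ^ (k - 2) := by
      rw [haberlandConst, show k - 1 = (k - 2) + 1 by omega, pow_succ]
      ring
    simp only [sum_conj_periodForm, Finset.mul_sum]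
    refine Finset.sum_congr rfl fun q _ => ?_
    rw [h2]
    linear_combination -(2 * Complex.I) * (projIndex Γ : ℂ)⁻¹ * slashExt k f q.out z *
      conj (slashExt k g q.out z) * h1
  have hsum : ∫ z in fdSet, ∑ q : Quotient (QuotientGroup.rightRel (plusMinus Γ)),
      slashExt k f q.out z * conj (slashExt k g q.out z) * (z.im : ℂ) ^ (k - 2) =
      ∑ q : Quotient (QuotientGroup.rightRel (plusMinus Γ)), ∫ z in fdSet,
        slashExt k f q.out z * conj (slashExt k g q.out z) * (z.im : ℂ) ^ (k - 2) :=
    integral_finsetSum Finset.univ fun q _ => integrableOn_fdSet_slashExt f g q.out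
  simp only [hfd, hpt]
  rw [integral_const_mul, hsum]
  ring

end

end Haberland

end

theorem theorem3p1 (Γ : Subgroup SL(2, ℤ)) [Γ.FiniteIndex] (k : ℕ) (hk : 2 ≤ k)
    (f g : CuspForm (Γ.map (mapGL ℝ)) (k : ℤ)) :
    (∀ (A : SL(2, ℤ)) (n : ℕ),
      IntegrableOn (Haberland.periodIntegrand k f A n) (Set.Ioi (0 : ℝ))) ∧
    (∃ D : Set ℍ, IsFundamentalDomain (Haberland.projGroup Γ) D volume) ∧
    (∀ D : Set ℍ, IsFundamentalDomain (Haberland.projGroup Γ) D volume →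
      IntegrableOn (Haberland.peterssonIntegrand k f g) D ∧
      6 * Haberland.haberlandConst k * Haberland.peterssonProduct Γ D k f g =
        Haberland.bracket (Haberland.periodPoly hk f)
          (Haberland.conjCoeff (Haberland.periodPoly hk g))) ∧
    Haberland.bracket (Haberland.periodPoly hk f) (Haberland.periodPoly hk g) = 0 :=
  ⟨Haberland.integrableOn_periodIntegrand f, ⟨_, Haberland.isFundamentalDomain_iUnion⟩,
    fun _ hD => Haberland.petersson_eq_bracket hk f g hD, Haberland.bracket_periodPoly hk f g⟩
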